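/- Let $d\ge 1$. A $d$-weighted reachability game consists of a finite non-empty directed graph $(V,E)$ in which every vertex has a successor, a partition $V=V_1\uplus V_2$ of the vertices between two players, weights $w(e)\in\mathbb N^d$ on the edges, and a target set $F\subseteq V$. The cost profile of an infinite path (play) is the componentwise sum of the weights up to its first visit of $F$, and $(\infty,\dots,\infty)$ if $F$ is never visited. For $v\in V$ let $\mathrm{Ens}(v)$ be the set of all $x\in(\mathbb N\cup\{\infty\})^d$ for which player 1 has a strategy $\sigma_1$ from $v$ such that, for every strategy $\sigma_2$ of player 2 from $v$, the outcome of $(\sigma_1,\sigma_2)$ from $v$ has a cost profile $\le x$ in the componentwise order. The Pareto frontier from $v$ is the set $\min\mathrm{Ens}(v)$ of minimal elements of $\mathrm{Ens}(v)$. Put $W=\max\{w_i(e) : e\in E,\ 1\le i\le d\}$ and $W'=\max(W,1)$. The fixpoint algorithm (for the componentwise order) computes, for $k=0,1,2,\dots$ and all $v\in V$, the sets $I^k(v)$ given by $I^k(v)=\{(0,\dots,0)\}$ for $v\in F$ and all $k$, by $I^0(v)=\{(\infty,\dots,\infty)\}$ for $v\notin F$, and for $v\notin F$ by $$I^{k+1}(v)=\min\Big(\bigcup_{(v,v')\in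 E}\big(\uparrow I^k(v')+w(v,v')\big)\Big)\ (v\in V_1),\qquad I^{k+1}(v)=\min\Big(\bigcap_{(v,v')\in E}\big(\uparrow I^k(v')+w(v,v')\big)\Big)\ (v\in V_2),$$ until $I^{k+1}(v)=I^k(v)$ for all $v$. Here $\uparrow X$ is the upward closure and $\min$ denotes the set of minimal elements. For $v\in V_1\setminus F$ it also records, for $x\in I^{k+1}(v)$, the old pair $f^k_v(x)$ if $x\in I^k(v)$, and otherwise a pair $f^{k+1}_v(x)=(v',x')$ with $(v,v')\in E$, $x'\in I^k(v')$ and $x=x'+w(v,v')$. Upward closed sets are represented by finite lists of generators: a union is a concatenation, an intersection takes all componentwise maxima of generators and is computed successively over the successors with a minimization after each step, and the minimal elements are obtained by pairwise comparison of generators. Running time is the number of elementary steps, where an operation ($\le$, $=$, $+$, $\max$) on two numbers of $\mathbb N\cup\{\infty\}$, an array access or a list step costs one. **Theorem.** There is a universal constant $C$ such that for every $d\ge1$, every $d$-weighted reachability game and every enumeration of the successors of its vertices, the lists computed after $k$ iterations represent exactly the sets $I^k(v)$ for all $k$ and $v$, and the algorithm terminates, with the Pareto frontier $\min\mathrm{Ens}(v)$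 as output for every $v\in V$, after at most $$C\cdot d^4\cdot W'^{\,4d}\cdot|V|^{4d+3}$$ elementary steps. Thus the running time is polynomial in $W$ and $|V|$ and exponential in $d$. In particular the computation is pseudo-polynomial for fixed $d$: for every $d\ge1$ there is a polynomial $p_d$ such that on every $d$-weighted reachability game the algorithm terminates with the Pareto frontiers after at most $p_d(W+|V|)$ elementary steps. -/

import Mathlib

/-! ### Weighted arenas and multi-weighted reachability games -/

inductive Player : Type
  | one
  | two
  deriving DecidableEq

/-- Cost profiles: `d`-tuples over `ℕ ∪ {∞}`. The order `≤` on this type is the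
componentwise order. -/
abbrev Profile (d : ℕ) : Type := Fin d → ℕ∞

/-- A `d`-weighted reachability game: an arena whose vertices are split between the two players
(by `owner`), whose edges carry `d` natural numbers, and a target set. Every vertex has a successor,
so that plays are infinite. Only the values of `weight` on edges matter. -/
structure Game (V : Type*) (d : ℕ) where
  owner : V → Player
  edge : V → V → Prop
  weight : V → V → Fin d → ℕ
  target : Finset V
  exists_succ : ∀ v, ∃ v', edge v v'

namespace Game

variable {V : Type*} {d : ℕ}

/-- The largest weight occurring on an edge. -/
noncomputable def maxWeight [Fintype V] (G : Game V d) : ℕ :=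
  open Classical in
  (Finset.univ.filter fun e : V × V => G.edge e.1 e.2).sup fun e =>
    Finset.univ.sup fun i => G.weight e.1 e.2 i

/-- The weight of an edge as a cost profile. -/
def weightProfile (G : Game V d) (v v' : V) : Profile d := fun i => (G.weight v v' i : ℕ∞)

/-- The cost profile of a play: the componentwise sum of the weights up to the first visit of the
target set, or `∞` in every component if the target set is not visited. -/
noncomputable def cost (G : Game V d) (ρ : ℕ → V) : Profile d :=
  open Classical in
  if h : ∃ n, ρ n ∈ G.target then
    ∑ n ∈ Finset.range (Nat.find h), G.weightProfile (ρ n) (ρ (n + 1))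
  else ⊤

/-- Histories from `v`, listed from the first vertex (which is `v`) to the last one. -/
def IsHistory (G : Game V d) (v : V) (h : List V) : Prop :=
  h.head? = some v ∧ h.IsChain G.edge

/-- A strategy of player `p` from `v`. Only the values of `next` on histories from `v` that end in a
vertex of `p` are constrained, and only these matter. -/
structure Strategy (G : Game V d) (p : Player) (v : V) where
  next : List V → V
  edge_next : ∀ h, G.IsHistory v h → ∀ u, h.getLast? = some u → G.owner u = p → G.edge u (next h)

/-- The history formed by the first `n + 1` vertices of the outcome of two strategies from `v`. -/
def outcomeHistory (G : Game V d) {v : V} (σ₁ : G.Strategy Player.one v)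
    (σ₂ : G.Strategy Player.two v) : ℕ → List V
  | 0 => [v]
  | n + 1 =>
    let h := G.outcomeHistory σ₁ σ₂ n
    h ++ [if G.owner (h.getLastD v) = Player.one then σ₁.next h else σ₂.next h]

/-- The outcome of two strategies from `v`. -/
def outcome (G : Game V d) {v : V} (σ₁ : G.Strategy Player.one v)
    (σ₂ : G.Strategy Player.two v) (n : ℕ) : V :=
  (G.outcomeHistory σ₁ σ₂ n).getLastD v

/-- The cost profiles that player one can ensure from `v`, for the componentwise order. -/
def ensured (G : Game V d) (v : V) : Set (Profile d) :=
  {x | ∃ σ₁ : G.Strategy Player.one v, ∀ σ₂ : G.Strategy Player.two v,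
    G.cost (G.outcome σ₁ σ₂) ≤ x}

end Game

/-- The set of minimal elements of a set of cost profiles. -/
def minimals {d : ℕ} (X : Set (Profile d)) : Set (Profile d) := {x | Minimal (· ∈ X) x}

/-- The upward closure of a set of cost profiles. -/
def upward {d : ℕ} (X : Set (Profile d)) : Set (Profile d) := {x | ∃ y ∈ X, y ≤ x}

/-- The set `X + w`. -/
def shift {d : ℕ} (X : Set (Profile d)) (w : Profile d) : Set (Profile d) := (fun x => x + w) '' X

namespace Game

variable {V : Type*} {d : ℕ}

/-- The Pareto frontier from `v`. -/
def pareto (G : Game V d) (v : V) : Set (Profile d) := minimals (G.ensured v)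

/-- The sets `I^k(v)` of the fixpoint algorithm, as abstract sets. -/
def iter [DecidableEq V] (G : Game V d) : ℕ → V → Set (Profile d)
  | 0, v => if v ∈ G.target then {0} else {⊤}
  | k + 1, v =>
    if v ∈ G.target then {0}
    else if G.owner v = Player.one then
      minimals (⋃ v' ∈ {u | G.edge v u}, shift (upward (G.iter k v')) (G.weightProfile v v'))
    else
      minimals (⋂ v' ∈ {u | G.edge v u}, shift (upward (G.iter k v')) (G.weightProfile v v'))

end Game

/-! ### Step counting

A computation returns a value together with the number of elementary steps it takes. The elementary
steps, of cost one each, are: one operation (`≤`, `=`, `+`, `max`) on two numbers, one test or one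
access to an array cell, the creation of a list cell, one step along a list, and the writing of one
array cell. -/

structure Timed (α : Type*) where
  val : α
  time : ℕ

namespace Timed

variable {α β σ ι : Type*}

/-- Return a value that is already there, at no cost. -/
def pure (a : α) : Timed α := ⟨a, 0⟩

/-- Sequential composition. -/
def bind (m : Timed α) (f : α → Timed β) : Timed β :=
  ⟨(f m.val).val, m.time + (f m.val).time⟩

/-- One elementary step with result `a`. -/
def step (a : α) : Timed α := ⟨a, 1⟩

/-- Fill an array: compute and write the cells one after the other. -/
def fill [Fintype ι] (f : ι → Timed α) : Timed (ι → α) :=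
  ⟨fun i => (f i).val, ∑ i, ((f i).time + 1)⟩

/-- Go through all indices and test whether the computed Booleans are all true. -/
def allIdx [Fintype ι] (f : ι → Timed Bool) : Timed Bool :=
  ⟨decide (∀ i, (f i).val = true), ∑ i, ((f i).time + 1)⟩

/-- Apply `f` to each element of a list. -/
def map (f : α → Timed β) : List α → Timed (List β)
  | [] => step []
  | a :: l =>
    (f a).bind fun b =>
    (map f l).bind fun r =>
    step (b :: r)

/-- Search a list for an element that passes a test. -/
def any (p : α → Timed Bool) : List α → Timed Bool
  | [] => step false
  | a :: l =>
    (p a).bind fun b =>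
    if b then step true else
      (any p l).bind fun r =>
      step r

/-- The elements of a list that pass a test. -/
def filter (p : α → Timed Bool) : List α → Timed (List α)
  | [] => step []
  | a :: l =>
    (p a).bind fun b =>
    (filter p l).bind fun r =>
    if b then step (a :: r) else step r

/-- Search a list for the first element on which `f` returns a result. -/
def findSome (f : α → Timed (Option β)) : List α → Timed (Option β)
  | [] => step none
  | a :: l =>
    (f a).bind fun b =>
    match b with
    | some c => step (some c)
    | none =>
      (findSome f l).bind fun r =>
      step r

/-- The results of `f` on the elements of a list, where there is one. -/
def collect (f : α → Timed (Option β)) : List α → Timed (List β)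
  | [] => step []
  | a :: l =>
    (f a).bind fun b =>
    (collect f l).bind fun r =>
    match b with
    | some c => step (c :: r)
    | none => step r

/-- Concatenation, which copies the first list. -/
def append : List α → List α → Timed (List α)
  | [], m => step m
  | a :: l, m =>
    (append l m).bind fun r =>
    step (a :: r)

/-- Loop over a list, updating a variable. -/
def fold (f : σ → α → Timed σ) : σ → List α → Timed σ
  | s, [] => step s
  | s, a :: l =>
    (f s a).bind fun s' =>
    (fold f s' l).bind fun r =>
    step r

/-- `RepeatUntil body s s' t`: the loop that executes `body` until it returns the flag `true`,
started with `s` in its variable, terminates with `s'` after `t` steps in total. -/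
inductive RepeatUntil (body : σ → Timed (σ × Bool)) : σ → σ → ℕ → Prop
  | done (s : σ) (h : (body s).val.2 = true) :
      RepeatUntil body s (body s).val.1 ((body s).time + 1)
  | again (s s' : σ) (t : ℕ) (h : (body s).val.2 = false)
      (hr : RepeatUntil body (body s).val.1 s' t) :
      RepeatUntil body s s' ((body s).time + 1 + t)

end Timed

/-! ### Operations on cost profiles and on finite sets of generators (as lists) -/

namespace Profile

variable {d : ℕ}

def leT (x y : Profile d) : Timed Bool := Timed.allIdx fun i => Timed.step (decide (x i ≤ y i))

def eqT (x y : Profile d) : Timed Bool := Timed.allIdx fun i => Timed.step (decide (x i = y i))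

def addT (x y : Profile d) : Timed (Profile d) := Timed.fill fun i => Timed.step (x i + y i)

noncomputable def maxT (x y : Profile d) : Timed (Profile d) :=
  Timed.fill fun i => Timed.step (max (x i) (y i))

def constT (c : ℕ∞) : Timed (Profile d) := Timed.fill fun _ => Timed.step c

/-- Membership in a list of cost profiles. -/
def memT (x : Profile d) (l : List (Profile d)) : Timed Bool := Timed.any (fun y => eqT y x) l

/-- Inclusion of lists of cost profiles, as sets. -/
def subsetT (l m : List (Profile d)) : Timed Bool :=
  (Timed.any (fun x =>
    (memT x m).bind fun c =>
    Timed.step (!c)) l).bind fun b =>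
  Timed.step (!b)

/-- Equality of lists of cost profiles, as sets. -/
def sameT (l m : List (Profile d)) : Timed Bool :=
  (subsetT l m).bind fun a =>
  (subsetT m l).bind fun b =>
  Timed.step (a && b)

/-- Add a generator `x` to a list of pairwise incomparable generators, and drop those that are no
longer minimal. -/
def insertT (l : List (Profile d)) (x : Profile d) : Timed (List (Profile d)) :=
  (Timed.any (fun y => leT y x) l).bind fun b =>
  if b then Timed.step l else
    (Timed.filter (fun y =>
      (leT x y).bind fun c =>
      Timed.step (!c)) l).bind fun r =>
    Timed.step (x :: r)

/-- The minimal elements of a list of generators. -/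
def minimizeT (l : List (Profile d)) : Timed (List (Profile d)) := Timed.fold insertT [] l

/-- Translation: generators of `↑l + w`. -/
def translateT (l : List (Profile d)) (w : Profile d) : Timed (List (Profile d)) :=
  Timed.map (fun x => addT x w) l

/-- Intersection: generators of `↑l ∩ ↑m`, obtained by taking all componentwise maxima. -/
noncomputable def interT : List (Profile d) → List (Profile d) → Timed (List (Profile d))
  | [], _ => Timed.step []
  | x :: l, m =>
    (Timed.map (fun y => maxT x y) m).bind fun a =>
    (interT l m).bind fun r =>
    Timed.append a r

end Profile

/-! ### The fixpoint algorithm -/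

/-- The successor lists of a game, in an arbitrary order and without repetitions. -/
structure SuccLists {V : Type*} {d : ℕ} (G : Game V d) where
  succ : V → List V
  nodup : ∀ v, (succ v).Nodup
  mem_succ : ∀ v v', v' ∈ succ v ↔ G.edge v v'

/-- The arrays of the algorithm: `I v` lists the elements of `I^k(v)`, and `f v` lists the pairs
`(x, (v', x'))` such that `f^k_v(x) = (v', x')`. -/
structure AlgState (V : Type*) (d : ℕ) where
  I : V → List (Profile d)
  f : V → List (Profile d × (V × Profile d))

namespace Game

variable {V : Type*} {d : ℕ}

/-- Initialisation: `I^0(v) = {0}` on the target set and `I^0(v) = {∞}` elsewhere. -/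
def initT [Fintype V] [DecidableEq V] (G : Game V d) : Timed (AlgState V d) :=
  (Timed.fill fun v : V =>
    (Timed.step (decide (v ∈ G.target))).bind fun b =>
    (Profile.constT (if b then 0 else ⊤)).bind fun x =>
    Timed.step [x]).bind fun I =>
  (Timed.fill fun _ : V => Timed.step []).bind fun f =>
  Timed.pure ⟨I, f⟩

/-- Generators of the union of the sets `↑I(v') + w(v, v')` over a list of vertices `v'`. -/
def unionT (G : Game V d) (s : AlgState V d) (v : V) : List V → Timed (List (Profile d))
  | [] => Timed.step []
  | v' :: l =>
    (Timed.step (s.I v')).bind fun a =>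
    (Profile.translateT a (G.weightProfile v v')).bind fun j =>
    (G.unionT s v l).bind fun r =>
    Timed.append j r

/-- The minimal elements of the intersection of the sets `↑I(v') + w(v, v')` over the successors
`v'` of `v`: start with `I(u)` for the first successor `u`, then intersect and minimize
successively. -/
noncomputable def interAllT (G : Game V d) (s : AlgState V d) (v : V) (succ : List V) :
    Timed (List (Profile d)) :=
  match succ with
  | [] => Timed.step []
  | u :: l =>
    (Timed.step (s.I u)).bind fun a =>
    Timed.fold (fun i v' =>
      (Timed.step (s.I v')).bind fun b =>
      (Profile.translateT b (G.weightProfile v v')).bind fun j =>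
      (Profile.interT i j).bind fun c =>
      Profile.minimizeT c) a (u :: l)

/-- The new value of `I(v)`. -/
noncomputable def updateIT [DecidableEq V] (G : Game V d) (L : SuccLists G)
    (s : AlgState V d) (v : V) : Timed (List (Profile d)) :=
  (Timed.step (decide (v ∈ G.target))).bind fun b =>
  if b then
    (Profile.constT 0).bind fun x =>
    Timed.step [x]
  else
    (Timed.step (decide (G.owner v = Player.one))).bind fun c =>
    if c then
      (G.unionT s v (L.succ v)).bind fun u =>
      Profile.minimizeT u
    else G.interAllT s v (L.succ v)

/-- Look up the old value of `f_v(x)`. -/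
def lookupT (s : AlgState V d) (v : V) (x : Profile d) : Timed (Option (V × Profile d)) :=
  Timed.findSome (fun e =>
    (Profile.eqT e.1 x).bind fun b =>
    Timed.step (if b then some e.2 else none)) (s.f v)

/-- Search for a successor `v'` of `v` and some `x' ∈ I(v')` such that `x = x' + w(v, v')`. -/
def searchT (G : Game V d) (L : SuccLists G) (s : AlgState V d) (v : V) (x : Profile d) :
    Timed (Option (V × Profile d)) :=
  Timed.findSome (fun v' => Timed.findSome (fun x' =>
    (Profile.addT x' (G.weightProfile v v')).bind fun y =>
    (Profile.eqT y x).bind fun b =>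
    Timed.step (if b then some (v', x') else none)) (s.I v')) (L.succ v)

/-- The new value of `f_v`, on the elements of the new value `new` of `I(v)`. -/
def updateFT [DecidableEq V] (G : Game V d) (L : SuccLists G) (s : AlgState V d) (v : V)
    (new : List (Profile d)) : Timed (List (Profile d × (V × Profile d))) :=
  (Timed.step (decide (v ∉ G.target ∧ G.owner v = Player.one))).bind fun b =>
  if b then
    Timed.collect (fun x =>
      (Profile.memT x (s.I v)).bind fun old =>
      (if old then lookupT s v x else G.searchT L s v x).bind fun r =>
      Timed.step (r.map fun p => (x, p))) new
  else Timed.step []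

/-- One iteration of the main loop: compute the arrays of step `k + 1` from those of step `k`, and
test whether `I^{k+1}(v) = I^k(v)` for all `v`. -/
noncomputable def roundT [Fintype V] [DecidableEq V] (G : Game V d) (L : SuccLists G)
    (s : AlgState V d) : Timed (AlgState V d × Bool) :=
  (Timed.fill fun v => G.updateIT L s v).bind fun I =>
  (Timed.fill fun v => G.updateFT L s v (I v)).bind fun f =>
  (Timed.allIdx fun v => Profile.sameT (I v) (s.I v)).bind fun b =>
  Timed.pure (⟨I, f⟩, b)

/-- The arrays after `k` iterations of the main loop (regardless of the stopping condition). -/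
noncomputable def stateAfter [Fintype V] [DecidableEq V] (G : Game V d)
    (L : SuccLists G) (k : ℕ) : AlgState V d :=
  (fun s => (G.roundT L s).val.1)^[k] G.initT.val

/-- The fixpoint algorithm terminates on the game `G`, given by the successor lists `L`, with the
arrays `s`, after exactly `t` elementary steps. -/
def FixpointAlgorithm [Fintype V] [DecidableEq V] (G : Game V d) (L : SuccLists G)
    (s : AlgState V d) (t : ℕ) : Prop :=
  ∃ t' : ℕ, Timed.RepeatUntil (G.roundT L) G.initT.val s t' ∧ t = G.initT.time + t'

end Game

/-! ### Upward closures and minimal elements -/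

section Order

variable {d : ℕ}

/-! Everything is done with upward closed sets. The order on `Profile d` is well-founded, so an
upward closed set is generated by its minimal elements and no information is lost by minimizing. Let
`reach k v` be the upward closure of `I^k(v)`. It obeys the recursion without `min`, grows with `k`,
and consists of the profiles that player one can ensure within `k` steps.

Stabilization (`exists_finset_of_first_mem_reach`): if `x` enters `reach` at `v` exactly at step
`k`, some successor has a remaining profile entering exactly at step `k - 1`. Following these yields
`k + 1` distinct vertices, so nothing new enters after step `|V| - 1`.

Correctness: an element of `reach` gives a strategy of player one by gluing strategies of the
successors (`reach_subset_ensured`). Conversely, if `x` lies outside the stable `reach`, player two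
can use the history to keep the invariant that the cost paid so far plus any profile attainable from
the current vertex is not below `x` (`ensured_subset_reach`). Hence the frontier is `I^k(v)` for `k
= |V| - 1`. The lists computed are antichains that generate the right upward closed sets, so they
are exactly the sets of minimal elements.

Running time: let all profiles that occur lie in a set closed under maxima whose antichains have at
most `M` elements (`Narrow`). Every minimized list then has length at most `M`. The worst operation
minimizes the `M ^ 2` maxima of an intersection in time `O(d * M ^ 3)`. A round does this for each
vertex and successor, and there are at most `|V|` rounds, which gives `O(d * |V| ^ 3 * M ^ 3)`.

Size of `M`: minimal profiles other than `⊤` have components at most `(|V| - 1) * W`, so `M = (|V| *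
W + 1) ^ d` is possible. With `q = |V| * W'` one needs `(q + 1) ^ 3 ≤ q ^ 4`, true for `q ≥ 3`. For
`q ≤ 2` the loss would be exponential in `d`, so games with at most two vertices are treated apart:
their profiles form a chain and `M = 1`. -/

theorem mem_upward {X : Set (Profile d)} {x : Profile d} : x ∈ upward X ↔ ∃ y ∈ X, y ≤ x := Iff.rfl

theorem subset_upward (X : Set (Profile d)) : X ⊆ upward X := fun x hx => ⟨x, hx, le_rfl⟩

theorem mem_upward_of_le {X : Set (Profile d)} {x y : Profile d} (hx : x ∈ upward X) (h : x ≤ y) :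
    y ∈ upward X := by
  obtain ⟨z, hz, hzx⟩ := hx
  exact ⟨z, hz, hzx.trans h⟩

theorem upward_singleton_zero : upward ({0} : Set (Profile d)) = Set.univ :=
  Set.eq_univ_of_forall fun _ => ⟨0, rfl, fun _ => zero_le⟩

theorem upward_singleton_top : upward ({⊤} : Set (Profile d)) = {⊤} := by
  ext x
  simp [mem_upward]

/-- Well-foundedness of the componentwise order puts a minimal element below every element. -/
theorem upward_minimals {X : Set (Profile d)} (hX : ∀ x ∈ X, ∀ y, x ≤ y → y ∈ X) :
    upward (minimals X) = X := by
  ext x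
  constructor
  · rintro ⟨y, hy, hyx⟩
    exact hX y hy.1 x hyx
  · intro hx
    obtain ⟨y, hyx, hy⟩ := exists_minimal_le_of_wellFoundedLT (· ∈ X) x hx
    exact ⟨y, hy, hyx⟩

theorem minimals_upward (X : Set (Profile d)) : minimals (upward X) = minimals X := by
  ext x
  constructor
  · rintro ⟨⟨y, hy, hyx⟩, hmin⟩
    have hxy : x = y := le_antisymm (hmin (subset_upward X hy) hyx) hyx
    subst hxy
    exact ⟨hy, fun z hz hzx => hmin (subset_upward X hz) hzx⟩
  · rintro ⟨hx, hmin⟩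
    refine ⟨subset_upward X hx, ?_⟩
    rintro z ⟨y, hy, hyz⟩ hzx
    exact (hmin hy (hyz.trans hzx)).trans hyz

theorem minimals_singleton (a : Profile d) : minimals {a} = {a} := by
  ext x
  constructor
  · intro h
    exact h.1
  · rintro rfl
    exact ⟨rfl, fun y hy _ => le_of_eq (Eq.symm hy)⟩

theorem minimals_minimals (X : Set (Profile d)) : minimals (minimals X) = minimals X := by
  ext x
  constructor
  · intro h
    exact h.1
  · intro h
    exact ⟨h, fun y hy hyx => h.2 hy.1 hyx⟩

end Order

/-! ### Profiles attainable within `k` steps, and stabilization of the iteration -/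

namespace Game

variable {V : Type*} {d : ℕ}

theorem exists_add_weightProfile (G : Game V d) {v v' : V} {x : Profile d}
    (h : G.weightProfile v v' ≤ x) : ∃ y, x = y + G.weightProfile v v' :=
  ⟨x - G.weightProfile v v', (tsub_add_cancel_of_le h).symm⟩

/-- Cancellation is allowed because weights are finite, even where components of `x` or `y` are
infinite. -/
theorem add_weightProfile_le (G : Game V d) {v v' : V} {x y : Profile d} :
    x + G.weightProfile v v' ≤ y + G.weightProfile v v' ↔ x ≤ y := by
  constructor
  · intro h i
    have := h i
    simp only [Pi.add_apply] at this
    exact (ENat.add_le_add_iff_right (ENat.natCast_ne_top _)).1 this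
  · intro h
    gcongr

theorem top_add_weightProfile (G : Game V d) (v v' : V) : ⊤ + G.weightProfile v v' = ⊤ := by
  funext i
  simp

theorem mem_shift_of_le (G : Game V d) {X : Set (Profile d)} {v v' : V} {x y : Profile d}
    (hx : x ∈ shift (upward X) (G.weightProfile v v')) (h : x ≤ y) :
    y ∈ shift (upward X) (G.weightProfile v v') := by
  obtain ⟨z, hz, rfl⟩ := hx
  obtain ⟨t, rfl⟩ := G.exists_add_weightProfile (le_trans le_add_self h)
  exact ⟨t, mem_upward_of_le hz (G.add_weightProfile_le.1 h), rfl⟩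

/-- Upward closures of the sets computed by the fixpoint algorithm: the profiles that player one
can ensure within `k` steps. -/
def reach [DecidableEq V] (G : Game V d) (k : ℕ) (v : V) : Set (Profile d) := upward (G.iter k v)

section Reach

variable [DecidableEq V] (G : Game V d)

theorem iter_target {v : V} (hv : v ∈ G.target) (k : ℕ) : G.iter k v = {0} := by
  cases k <;> simp [iter, hv]

theorem iter_zero {v : V} (hv : v ∉ G.target) : G.iter 0 v = {⊤} := by
  simp [iter, hv]

theorem reach_target {v : V} (hv : v ∈ G.target) (k : ℕ) : G.reach k v = Set.univ := by
  rw [reach, iter_target G hv, upward_singleton_zero]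

theorem reach_zero {v : V} (hv : v ∉ G.target) : G.reach 0 v = {⊤} := by
  rw [reach, iter_zero G hv, upward_singleton_top]

theorem mem_reach_of_le {k : ℕ} {v : V} {x y : Profile d} (hx : x ∈ G.reach k v) (h : x ≤ y) :
    y ∈ G.reach k v := mem_upward_of_le hx h

theorem mem_reach_succ_one {v : V} (hv : v ∉ G.target) (ho : G.owner v = Player.one) {k : ℕ}
    {x : Profile d} : x ∈ G.reach (k + 1) v ↔
      ∃ v', G.edge v v' ∧ ∃ y ∈ G.reach k v', x = y + G.weightProfile v v' := by
  rw [reach, iter, if_neg hv, if_pos ho, upward_minimals]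
  · simp only [Set.mem_iUnion, Set.mem_ofPred_eq, shift, Set.mem_image, exists_prop, reach, eq_comm]
  · intro x hx y hxy
    simp only [Set.mem_iUnion] at hx ⊢
    obtain ⟨v', h, hx⟩ := hx
    exact ⟨v', h, G.mem_shift_of_le hx hxy⟩

theorem mem_reach_succ_two {v : V} (hv : v ∉ G.target) (ho : G.owner v ≠ Player.one) {k : ℕ}
    {x : Profile d} : x ∈ G.reach (k + 1) v ↔
      ∀ v', G.edge v v' → ∃ y ∈ G.reach k v', x = y + G.weightProfile v v' := by
  rw [reach, iter, if_neg hv, if_neg ho, upward_minimals]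
  · simp only [Set.mem_iInter, Set.mem_ofPred_eq, shift, Set.mem_image, reach, eq_comm]
  · intro x hx y hxy
    simp only [Set.mem_iInter] at hx ⊢
    exact fun v' h => G.mem_shift_of_le (hx v' h) hxy

theorem iter_eq_minimals (k : ℕ) (v : V) : G.iter k v = minimals (G.reach k v) := by
  rw [reach, minimals_upward]
  cases k <;> simp only [iter] <;> split_ifs <;>
    simp only [minimals_singleton, minimals_minimals]

theorem top_mem_reach (k : ℕ) (v : V) : ⊤ ∈ G.reach k v := by
  induction k generalizing v with
  | zero =>
    by_cases hv : v ∈ G.target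
    · simp [G.reach_target hv]
    · simp [G.reach_zero hv]
  | succ k ih =>
    by_cases hv : v ∈ G.target
    · simp [G.reach_target hv]
    by_cases ho : G.owner v = Player.one
    · obtain ⟨v', h⟩ := G.exists_succ v
      exact (G.mem_reach_succ_one hv ho).2 ⟨v', h, ⊤, ih v', (G.top_add_weightProfile v v').symm⟩
    · exact (G.mem_reach_succ_two hv ho).2
        fun v' _ => ⟨⊤, ih v', (G.top_add_weightProfile v v').symm⟩

theorem reach_mono_succ (k : ℕ) (v : V) : G.reach k v ⊆ G.reach (k + 1) v := by
  induction k generalizing v with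
  | zero =>
    by_cases hv : v ∈ G.target
    · simp [G.reach_target hv]
    · rw [G.reach_zero hv]
      rintro x rfl
      exact G.top_mem_reach 1 v
  | succ k ih =>
    by_cases hv : v ∈ G.target
    · simp [G.reach_target hv]
    intro x hx
    by_cases ho : G.owner v = Player.one
    · obtain ⟨v', h, y, hy, e⟩ := (G.mem_reach_succ_one hv ho).1 hx
      exact (G.mem_reach_succ_one hv ho).2 ⟨v', h, y, ih v' hy, e⟩
    · refine (G.mem_reach_succ_two hv ho).2 fun v' h => ?_
      obtain ⟨y, hy, e⟩ := (G.mem_reach_succ_two hv ho).1 hx v' h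
      exact ⟨y, ih v' hy, e⟩

theorem reach_mono {j k : ℕ} (h : j ≤ k) (v : V) : G.reach j v ⊆ G.reach k v :=
  monotone_nat_of_le_succ (f := fun k => G.reach k v) (fun k => G.reach_mono_succ k v) h

/-- A profile that enters at step `k` comes with `k + 1` distinct vertices. -/
theorem exists_finset_of_first_mem_reach (k : ℕ) (v : V) (x : Profile d) (hx : x ∈ G.reach k v)
    (hmin : ∀ j < k, x ∉ G.reach j v) :
    ∃ S : Finset V, S.card = k + 1 ∧ ∀ u ∈ S, ∃ j ≤ k, ∃ y ≤ x, y ∈ G.reach j u := by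
  induction k generalizing v x with
  | zero => exact ⟨{v}, by simp, fun u hu => ⟨0, le_rfl, x, le_rfl, by simp_all⟩⟩
  | succ k ih =>
    have hv : v ∉ G.target := fun hv => hmin 0 (Nat.succ_pos k) (by simp [G.reach_target hv])
    -- Some successor carries a remaining profile that enters exactly at step `k`.
    obtain ⟨v', y, hy, hymin, hyx⟩ : ∃ v' y, y ∈ G.reach k v' ∧ (∀ j < k, y ∉ G.reach j v') ∧
        y ≤ x := by
      by_cases ho : G.owner v = Player.one
      · obtain ⟨v', h, y, hy, rfl⟩ := (G.mem_reach_succ_one hv ho).1 hx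
        exact ⟨v', y, hy, fun j hj hyj => hmin (j + 1) (by lia)
          ((G.mem_reach_succ_one hv ho).2 ⟨v', h, y, hyj, rfl⟩), le_self_add⟩
      -- At a vertex of player two, if all remaining profiles had entered before step `k`, then `x`
      -- would have entered at `v` by step `k`.
      · by_contra hcon
        push Not at hcon
        have key : ∀ v', G.edge v v' → ∃ j < k, ∃ y ∈ G.reach j v',
            x = y + G.weightProfile v v' := by
          intro v' h
          obtain ⟨y, hy, rfl⟩ := (G.mem_reach_succ_two hv ho).1 hx v' h
          by_contra hno
          refine hcon v' y hy (fun j hj hyj => hno ⟨j, hj, y, hyj, rfl⟩) le_self_add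
        obtain ⟨v₀, h₀⟩ := G.exists_succ v
        obtain ⟨j₀, hj₀, -⟩ := key v₀ h₀
        obtain ⟨m, rfl⟩ : ∃ m, k = m + 1 := ⟨k - 1, by lia⟩
        refine hmin (m + 1) (by lia) ((G.mem_reach_succ_two hv ho).2 fun v' h => ?_)
        obtain ⟨j, hj, y, hy, e⟩ := key v' h
        exact ⟨y, G.reach_mono (by lia) v' hy, e⟩
    obtain ⟨S, hS, hSu⟩ := ih v' y hy hymin
    refine ⟨insert v S, ?_, ?_⟩
    · rw [Finset.card_insert_of_notMem, hS]
      -- Vertices of `S` attain a profile below `x` within `k` steps, but `v` needs `k + 1` steps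
      -- for `x`.
      intro hvS
      obtain ⟨j, hj, z, hz, hzj⟩ := hSu v hvS
      exact hmin j (by lia) (G.mem_reach_of_le hzj (hz.trans hyx))
    · intro u hu
      rcases Finset.mem_insert.1 hu with rfl | hu
      · exact ⟨k + 1, le_rfl, x, le_rfl, hx⟩
      · obtain ⟨j, hj, z, hz, hzj⟩ := hSu u hu
        exact ⟨j, by lia, z, hz.trans hyx, hzj⟩

/-- Each iterate is a function of the previous one, so one repetition makes the sequence constant.
-/
theorem iter_add_eq {j : ℕ} (h : ∀ v, G.iter (j + 1) v = G.iter j v) (m : ℕ) (v : V) :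
    G.iter (j + m) v = G.iter j v := by
  induction m generalizing v with
  | zero => rfl
  | succ m ih =>
    rw [← h v, ← add_assoc, iter, iter]
    simp only [ih]

variable [Fintype V]

/-- The `k + 1` distinct vertices attached to a first entry at step `k` force `k + 1 ≤ |V|`. -/
theorem reach_subset_card (k : ℕ) (v : V) : G.reach k v ⊆ G.reach (Fintype.card V - 1) v := by
  classical
  intro x hx
  have hex : ∃ k, x ∈ G.reach k v := ⟨k, hx⟩
  obtain ⟨S, hS, -⟩ := G.exists_finset_of_first_mem_reach (Nat.find hex) v x (Nat.find_spec hex)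
    fun j hj => Nat.find_min hex hj
  have := S.card_le_univ
  exact G.reach_mono (by lia) v (Nat.find_spec hex)

theorem reach_eq_of_card_le {k : ℕ} (hk : Fintype.card V - 1 ≤ k) (v : V) :
    G.reach k v = G.reach (Fintype.card V - 1) v :=
  (G.reach_subset_card k v).antisymm (G.reach_mono hk v)

theorem iter_eq_of_card_le {k : ℕ} (hk : Fintype.card V - 1 ≤ k) (v : V) :
    G.iter k v = G.iter (Fintype.card V - 1) v := by
  rw [iter_eq_minimals, iter_eq_minimals, G.reach_eq_of_card_le hk]

theorem iter_card_eq_of_stable {j : ℕ} (h : ∀ v, G.iter (j + 1) v = G.iter j v) (v : V) :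
    G.iter (j + 1) v = G.iter (Fintype.card V - 1) v := by
  rw [h v, ← G.iter_add_eq h (Fintype.card V - 1) v, G.iter_eq_of_card_le (by lia)]

end Reach

end Game

/-! ### The profiles that player one can ensure -/

namespace Game

variable {V : Type*} {d : ℕ}

section Outcome

variable (G : Game V d)

theorem outcome_zero {v : V} (σ₁ : G.Strategy Player.one v) (σ₂ : G.Strategy Player.two v) :
    G.outcome σ₁ σ₂ 0 = v := rfl

theorem outcome_succ {v : V} (σ₁ : G.Strategy Player.one v) (σ₂ : G.Strategy Player.two v)
    (n : ℕ) : G.outcome σ₁ σ₂ (n + 1) =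
      if G.owner (G.outcome σ₁ σ₂ n) = Player.one then σ₁.next (G.outcomeHistory σ₁ σ₂ n)
        else σ₂.next (G.outcomeHistory σ₁ σ₂ n) := by
  rw [outcome, outcomeHistory]
  simp [outcome]

theorem outcomeHistory_succ {v : V} (σ₁ : G.Strategy Player.one v) (σ₂ : G.Strategy Player.two v)
    (n : ℕ) : G.outcomeHistory σ₁ σ₂ (n + 1) =
      G.outcomeHistory σ₁ σ₂ n ++ [G.outcome σ₁ σ₂ (n + 1)] := by
  rw [outcome_succ]
  rfl

theorem getLast?_outcomeHistory {v : V} (σ₁ : G.Strategy Player.one v)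
    (σ₂ : G.Strategy Player.two v) (n : ℕ) :
    (G.outcomeHistory σ₁ σ₂ n).getLast? = some (G.outcome σ₁ σ₂ n) := by
  cases n with
  | zero => rfl
  | succ n => rw [outcomeHistory_succ, List.getLast?_concat]

theorem player_eq_two {p : Player} (h : p ≠ Player.one) : p = Player.two := by
  cases p
  · exact absurd rfl h
  · rfl

theorem isHistory_outcomeHistory {v : V} (σ₁ : G.Strategy Player.one v)
    (σ₂ : G.Strategy Player.two v) (n : ℕ) : G.IsHistory v (G.outcomeHistory σ₁ σ₂ n) ∧
      G.edge (G.outcome σ₁ σ₂ n) (G.outcome σ₁ σ₂ (n + 1)) := by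
  have edge_of : ∀ n, G.IsHistory v (G.outcomeHistory σ₁ σ₂ n) →
      G.edge (G.outcome σ₁ σ₂ n) (G.outcome σ₁ σ₂ (n + 1)) := by
    intro n hn
    rw [outcome_succ]
    split_ifs with ho
    · exact σ₁.edge_next _ hn _ (G.getLast?_outcomeHistory σ₁ σ₂ n) ho
    · exact σ₂.edge_next _ hn _ (G.getLast?_outcomeHistory σ₁ σ₂ n) (player_eq_two ho)
  suffices h : G.IsHistory v (G.outcomeHistory σ₁ σ₂ n) from ⟨h, edge_of n h⟩
  induction n with
  | zero => exact ⟨rfl, List.isChain_singleton v⟩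
  | succ n ih =>
    have he := edge_of n ih
    rw [outcomeHistory_succ]
    refine ⟨?_, ?_⟩
    · rw [List.head?_append, ih.1]
      rfl
    · rw [List.isChain_append]
      refine ⟨ih.2, List.isChain_singleton _, ?_⟩
      intro a ha b hb
      rw [G.getLast?_outcomeHistory σ₁ σ₂ n] at ha
      simp only [List.head?_cons, Option.mem_def, Option.some.injEq] at ha hb
      rw [← ha, ← hb]
      exact he

/-- Strategies that agree after the first step have outcomes that agree after the first step. -/
theorem outcomeHistory_succ_eq_cons {v u : V} {σ₁ : G.Strategy Player.one v}
    {σ₂ : G.Strategy Player.two v} {τ₁ : G.Strategy Player.one u} {τ₂ : G.Strategy Player.two u}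
    (hu : G.outcome σ₁ σ₂ 1 = u) (h₁ : ∀ t, σ₁.next (v :: u :: t) = τ₁.next (u :: t))
    (h₂ : ∀ t, σ₂.next (v :: u :: t) = τ₂.next (u :: t)) (n : ℕ) :
    G.outcomeHistory σ₁ σ₂ (n + 1) = v :: G.outcomeHistory τ₁ τ₂ n ∧
      G.outcome σ₁ σ₂ (n + 1) = G.outcome τ₁ τ₂ n := by
  induction n with
  | zero =>
    refine ⟨?_, hu⟩
    rw [outcomeHistory_succ, hu]
    rfl
  | succ n ih =>
    obtain ⟨t, ht⟩ : ∃ t, G.outcomeHistory τ₁ τ₂ n = u :: t :=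
      List.head?_eq_some_iff.1 (G.isHistory_outcomeHistory τ₁ τ₂ n).1.1
    have e : G.outcome σ₁ σ₂ (n + 1 + 1) = G.outcome τ₁ τ₂ (n + 1) := by
      rw [outcome_succ G σ₁, outcome_succ G τ₁, ih.1, ih.2, ht, h₁, h₂]
    refine ⟨?_, e⟩
    rw [outcomeHistory_succ, outcomeHistory_succ G τ₁, e, ih.1, List.cons_append]

theorem cost_of_mem {ρ : ℕ → V} (h : ρ 0 ∈ G.target) : G.cost ρ = 0 := by
  classical
  have hex : ∃ n, ρ n ∈ G.target := ⟨0, h⟩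
  rw [cost, dif_pos hex, (Nat.find_eq_zero hex).2 h, Finset.sum_range_zero]

theorem cost_of_notMem {ρ : ℕ → V} (h : ρ 0 ∉ G.target) :
    G.cost ρ = G.cost (fun n => ρ (n + 1)) + G.weightProfile (ρ 0) (ρ 1) := by
  classical
  by_cases hex : ∃ n, ρ n ∈ G.target
  · have hex' : ∃ n, ρ (n + 1) ∈ G.target := by
      obtain ⟨n, hn⟩ := hex
      cases n with
      | zero => exact absurd hn h
      | succ n => exact ⟨n, hn⟩
    rw [cost, dif_pos hex, cost, dif_pos hex', Nat.find_comp_succ hex hex' h,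
      Finset.sum_range_succ']
  · have hex' : ¬ ∃ n, ρ (n + 1) ∈ G.target := fun ⟨n, hn⟩ => hex ⟨n + 1, hn⟩
    rw [cost, dif_neg hex, cost, dif_neg hex', top_add_weightProfile]

end Outcome

/-- Move to `c`, or wherever the opponent wants, and then follow a strategy from there. -/
def Strategy.prepend {G : Game V d} {p : Player} {v c : V} (hc : G.edge v c)
    (σ : ∀ u, G.Strategy p u) : G.Strategy p v where
  next
    | _ :: u :: t => (σ u).next (u :: t)
    | _ => c
  edge_next := by
    rintro (_ | ⟨a, _ | ⟨b, t⟩⟩) hh u hu ho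
    · cases hu
    · obtain rfl : a = v := Option.some.inj hh.1
      obtain rfl : a = u := Option.some.inj hu
      exact hc
    · exact (σ b).edge_next (b :: t) ⟨rfl, hh.2.tail⟩ u (by simpa using hu) ho

/-- The continuation of a strategy after one step. -/
def Strategy.tail {G : Game V d} {p : Player} {v u : V} (hu : G.edge v u)
    (σ : G.Strategy p v) : G.Strategy p u where
  next h := σ.next (v :: h)
  edge_next h hh a ha ho := by
    obtain ⟨t, rfl⟩ := List.head?_eq_some_iff.1 hh.1
    exact σ.edge_next (v :: u :: t) ⟨rfl, hh.2.cons_cons hu⟩ a (by simpa using ha) ho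

/-! ### Ensured profiles coincide with the stable attainable ones -/

section Ensured

variable (G : Game V d)

theorem exists_strategy (p : Player) (v : V) : Nonempty (G.Strategy p v) := by
  choose s hs using G.exists_succ
  refine ⟨⟨fun h => s (h.getLastD v), fun h _ u hu _ => ?_⟩⟩
  rw [List.getLastD_eq_getLast?, hu]
  exact hs u

/-- Serves both owners: the first move is forced to be `c` only if player one owns `v`. After it,
the play is the outcome of the strategy chosen at `u` against the tail of the opponent's strategy.
-/
theorem mem_ensured_of_forall {v : V} (hv : v ∉ G.target) {x : Profile d}
    {c : V} (hc : G.edge v c)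
    (h : ∀ u, G.edge v u → (G.owner v = Player.one → u = c) →
      ∃ y ∈ G.ensured u, x = y + G.weightProfile v u) : x ∈ G.ensured v := by
  -- Vertices that cannot come next get an arbitrary strategy, so that one can be chosen for every
  -- `u`.
  have key : ∀ u, ∃ σ : G.Strategy Player.one u, G.edge v u → (G.owner v = Player.one → u = c) →
      ∀ τ : G.Strategy Player.two u, G.cost (G.outcome σ τ) + G.weightProfile v u ≤ x := by
    intro u
    by_cases hu : G.edge v u ∧ (G.owner v = Player.one → u = c)
    · obtain ⟨y, ⟨σ, hσ⟩, rfl⟩ := h u hu.1 hu.2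
      exact ⟨σ, fun _ _ τ => G.add_weightProfile_le.2 (hσ τ)⟩
    · obtain ⟨σ⟩ := G.exists_strategy Player.one u
      exact ⟨σ, fun h₁ h₂ => absurd ⟨h₁, h₂⟩ hu⟩
  choose σ hσ using key
  refine ⟨Strategy.prepend hc σ, fun σ₂ => ?_⟩
  set u := G.outcome (Strategy.prepend hc σ) σ₂ 1 with hu
  have he : G.edge v u := (G.isHistory_outcomeHistory (Strategy.prepend hc σ) σ₂ 0).2
  have hown : G.owner v = Player.one → u = c := by
    intro ho
    rw [hu, outcome_succ, outcome_zero, if_pos ho]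
    rfl
  have := hσ u he hown (σ₂.tail he)
  rw [cost_of_notMem G (by rwa [outcome_zero])]
  simp only [(G.outcomeHistory_succ_eq_cons (τ₁ := σ u) (τ₂ := σ₂.tail he) hu.symm
    (fun t => rfl) (fun t => rfl) _).2]
  exact this

theorem reach_subset_ensured [DecidableEq V] (k : ℕ) (v : V) : G.reach k v ⊆ G.ensured v := by
  have target : ∀ v ∈ G.target, ∀ x, x ∈ G.ensured v := by
    intro v hv x
    obtain ⟨σ⟩ := G.exists_strategy Player.one v
    refine ⟨σ, fun τ => ?_⟩
    rw [cost_of_mem G (by rwa [outcome_zero])]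
    exact fun i => zero_le
  induction k generalizing v with
  | zero =>
    intro x hx
    by_cases hv : v ∈ G.target
    · exact target v hv x
    · rw [G.reach_zero hv] at hx
      obtain ⟨σ⟩ := G.exists_strategy Player.one v
      rw [Set.mem_singleton_iff.1 hx]
      exact ⟨σ, fun τ => le_top⟩
  | succ k ih =>
    intro x hx
    by_cases hv : v ∈ G.target
    · exact target v hv x
    by_cases ho : G.owner v = Player.one
    · obtain ⟨c, hc, y, hy, e⟩ := (G.mem_reach_succ_one hv ho).1 hx
      refine G.mem_ensured_of_forall hv hc fun u hu huc => ?_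
      obtain rfl := huc ho
      exact ⟨y, ih u hy, e⟩
    · obtain ⟨c, hc⟩ := G.exists_succ v
      refine G.mem_ensured_of_forall hv hc fun u hu _ => ?_
      obtain ⟨y, hy, e⟩ := (G.mem_reach_succ_two hv ho).1 hx u hu
      exact ⟨y, ih u hy, e⟩

/-- The cost profile of a finite path. -/
def pathCost : List V → Profile d
  | a :: b :: l => G.weightProfile a b + pathCost (b :: l)
  | _ => 0

theorem pathCost_concat {h : List V} {a : V} (ha : h.getLast? = some a) (b : V) :
    G.pathCost (h ++ [b]) = G.pathCost h + G.weightProfile a b := by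
  induction h with
  | nil => cases ha
  | cons c h ih =>
    cases h with
    | nil =>
      obtain rfl : c = a := Option.some.inj ha
      simp [pathCost]
    | cons e h =>
      have := ih (by simpa using ha)
      simp only [List.cons_append, pathCost] at this ⊢
      rw [this, add_assoc]

theorem pathCost_outcomeHistory {v : V} (σ₁ : G.Strategy Player.one v)
    (σ₂ : G.Strategy Player.two v) (n : ℕ) : G.pathCost (G.outcomeHistory σ₁ σ₂ n) =
      ∑ i ∈ Finset.range n, G.weightProfile (G.outcome σ₁ σ₂ i) (G.outcome σ₁ σ₂ (i + 1)) := by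
  induction n with
  | zero => rfl
  | succ n ih =>
    rw [outcomeHistory_succ, G.pathCost_concat (G.getLast?_outcomeHistory σ₁ σ₂ n), ih,
      Finset.sum_range_succ]

/-- At a stable step, player two can avoid whatever lies outside of `reach`. -/
theorem ensured_subset_reach [DecidableEq V] {N : ℕ} (hN : ∀ v, G.reach (N + 1) v = G.reach N v)
    (v : V) : G.ensured v ⊆ G.reach N v := by
  classical
  rintro x ⟨σ₁, hσ⟩
  by_contra hx
  -- The invariant of player two: after `h`, nothing attainable from `u` fits into the budget left
  -- by `x`.
  let Bad : List V → V → Prop := fun h u => ∀ y ∈ G.reach N u, ¬ G.pathCost h + y ≤ x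
  have bad_of_edge : ∀ h u v', u ∉ G.target → h.getLast? = some u → G.owner u = Player.one →
      G.edge u v' → Bad h u → Bad (h ++ [v']) v' := by
    intro h u v' hu hl ho he hb y hy hle
    refine hb (y + G.weightProfile u v') ?_ ?_
    · rw [← hN, G.mem_reach_succ_one hu ho]
      exact ⟨v', he, y, hy, rfl⟩
    · rwa [G.pathCost_concat hl, add_assoc, add_comm (G.weightProfile u v')] at hle
  have exists_bad : ∀ h u, u ∉ G.target → h.getLast? = some u → G.owner u ≠ Player.one →
      Bad h u → ∃ v', G.edge u v' ∧ Bad (h ++ [v']) v' := by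
    intro h u hu hl ho hb
    by_contra hcon
    push Not at hcon
    have key : ∀ v', G.edge u v' → ∃ y ∈ G.reach N v',
        y + G.weightProfile u v' + G.pathCost h ≤ x := by
      intro v' he
      have := hcon v' he
      simp only [Bad, not_forall, not_not] at this
      obtain ⟨y, hy, hle⟩ := this
      refine ⟨y, hy, ?_⟩
      rwa [G.pathCost_concat hl, add_comm, add_comm (G.pathCost h), ← add_assoc] at hle
    obtain ⟨v₀, h₀⟩ := G.exists_succ u
    obtain ⟨y₀, -, hy₀⟩ := key v₀ h₀
    have hle : G.pathCost h ≤ x := le_add_self.trans hy₀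
    -- The cost of a finite path is finite, so it can be cancelled.
    have hfin : ∀ i, G.pathCost h i ≠ ⊤ := by
      intro i
      suffices ∀ l : List V, G.pathCost l i ≠ ⊤ from this h
      intro l
      induction l with
      | nil => simp [pathCost]
      | cons a l ih =>
        cases l with
        | nil => simp [pathCost]
        | cons b l => simpa [pathCost, weightProfile] using ih
    -- If no successor were bad, the remaining budget would be attainable at every successor after
    -- paying the edge. By stability it would then be attainable at `u` itself.
    refine hb (x - G.pathCost h) ?_ (add_tsub_cancel_of_le hle).le
    rw [← hN, G.mem_reach_succ_two hu ho]
    intro v' he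
    obtain ⟨y, hy, hyx⟩ := key v' he
    have hyx' : y + G.weightProfile u v' ≤ x - G.pathCost h := by
      intro i
      have h1 := hyx i
      rw [← tsub_add_cancel_of_le hle] at h1
      exact (ENat.add_le_add_iff_right (hfin i)).1 h1
    obtain ⟨z, hz⟩ := G.exists_add_weightProfile (le_add_self.trans hyx')
    refine ⟨z, G.mem_reach_of_le hy ?_, hz⟩
    rw [hz] at hyx'
    exact G.add_weightProfile_le.1 hyx'
  -- Move to a bad successor if there is one. The other branch only makes the strategy total and is
  -- not taken before the target is reached.
  let nxt : List V → V := fun h =>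
    if H : ∃ v', G.edge (h.getLastD v) v' ∧ Bad (h ++ [v']) v' then H.choose
    else (G.exists_succ (h.getLastD v)).choose
  have nxt_edge : ∀ h, G.edge (h.getLastD v) (nxt h) := by
    intro h
    simp only [nxt]
    split_ifs with H
    · exact H.choose_spec.1
    · exact (G.exists_succ (h.getLastD v)).choose_spec
  let σ₂ : G.Strategy Player.two v := ⟨nxt, fun h _ u hu _ => by
    have := nxt_edge h
    rwa [List.getLastD_eq_getLast?, hu] at this⟩
  have inv : ∀ n, (∀ m < n, G.outcome σ₁ σ₂ m ∉ G.target) →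
      Bad (G.outcomeHistory σ₁ σ₂ n) (G.outcome σ₁ σ₂ n) := by
    intro n
    induction n with
    | zero =>
      intro _ y hy hle
      refine hx (G.mem_reach_of_le hy ?_)
      simpa [outcomeHistory, pathCost] using hle
    | succ n ih =>
      intro hn
      have hb := ih fun m hm => hn m (by lia)
      have hu := hn n (by lia)
      have hl := G.getLast?_outcomeHistory σ₁ σ₂ n
      have he := (G.isHistory_outcomeHistory σ₁ σ₂ n).2
      rw [outcomeHistory_succ]
      by_cases ho : G.owner (G.outcome σ₁ σ₂ n) = Player.one
      · exact bad_of_edge _ _ _ hu hl ho he hb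
      · have H := exists_bad _ _ hu hl ho hb
        rw [outcome_succ, if_neg ho]
        have e : σ₂.next (G.outcomeHistory σ₁ σ₂ n) = H.choose := dif_pos H
        rw [e]
        exact H.choose_spec.2
  have hcost := hσ σ₂
  by_cases hex : ∃ n, G.outcome σ₁ σ₂ n ∈ G.target
  · rw [cost, dif_pos hex, ← pathCost_outcomeHistory] at hcost
    -- On the target `0` is attainable, so the invariant says that the cost paid is not below `x`.
    have h0 : (0 : Profile d) ∈ G.reach N (G.outcome σ₁ σ₂ (Nat.find hex)) := by
      rw [G.reach_target (Nat.find_spec hex)]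
      trivial
    refine inv (Nat.find hex) (fun m hm => Nat.find_min hex hm) 0 h0 ?_
    rw [add_zero]
    convert hcost
  · rw [cost, dif_neg hex] at hcost
    exact hx (G.mem_reach_of_le (G.top_mem_reach N v) hcost)

theorem pareto_eq_iter [DecidableEq V] [Fintype V] (v : V) :
    G.pareto v = G.iter (Fintype.card V - 1) v := by
  rw [iter_eq_minimals, pareto, (G.ensured_subset_reach
    (fun v => G.reach_eq_of_card_le (by lia) v) v).antisymm (G.reach_subset_ensured _ v)]

end Ensured

end Game

/-! ### Values of the timed computations -/

namespace Timed

variable {α β σ : Type*}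

theorem any_val {p : α → Timed Bool} {l : List α} :
    (any p l).val = true ↔ ∃ a ∈ l, (p a).val = true := by
  induction l with
  | nil => simp [any, step]
  | cons a l ih =>
    cases h : (p a).val <;> simp [any, bind, step, h, ih]

theorem map_val (f : α → Timed β) (l : List α) : (map f l).val = l.map fun a => (f a).val := by
  induction l with
  | nil => rfl
  | cons a l ih => simp [map, bind, step, ih]

theorem filter_val (p : α → Timed Bool) (l : List α) :
    (filter p l).val = l.filter fun a => (p a).val := by
  induction l with
  | nil => rfl
  | cons a l ih => cases h : (p a).val <;> simp [filter, bind, step, h, ih]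

theorem append_val (l m : List α) : (append l m).val = l ++ m := by
  induction l with
  | nil => rfl
  | cons a l ih => simp [append, bind, step, ih]

theorem fold_val (f : σ → α → Timed σ) (s : σ) (l : List α) :
    (fold f s l).val = l.foldl (fun s a => (f s a).val) s := by
  induction l generalizing s with
  | nil => rfl
  | cons a l ih => simp [fold, bind, step, ih]

theorem length_collect_le (f : α → Timed (Option β)) (l : List α) :
    (collect f l).val.length ≤ l.length := by
  induction l with
  | nil => simp [collect, step]
  | cons a l ih =>
    cases h : (f a).val with
    | none => simpa [collect, bind, step, h] using ih.trans (Nat.le_succ _)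
    | some c => simpa [collect, bind, step, h] using ih

end Timed

namespace Profile

variable {d : ℕ}

theorem leT_val (x y : Profile d) : (leT x y).val = true ↔ x ≤ y := by
  simp [leT, Timed.allIdx, Timed.step, Pi.le_def]

theorem eqT_val (x y : Profile d) : (eqT x y).val = true ↔ x = y := by
  simp [eqT, Timed.allIdx, Timed.step, funext_iff]

theorem maxT_val (x y : Profile d) : (maxT x y).val = x ⊔ y := rfl

theorem memT_val {x : Profile d} {l : List (Profile d)} : (memT x l).val = true ↔ x ∈ l := by
  simp [memT, Timed.any_val, eqT_val]

theorem subsetT_val {l m : List (Profile d)} : (subsetT l m).val = true ↔ ∀ x ∈ l, x ∈ m := by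
  have h : ∀ b : Bool, (!b) = true ↔ ¬ b = true := by decide
  simp only [subsetT, Timed.bind, Timed.step, h, Timed.any_val, memT_val]
  push Not
  rfl

theorem sameT_val {l m : List (Profile d)} :
    (sameT l m).val = true ↔ {x | x ∈ l} = {x | x ∈ m} := by
  simp only [sameT, Timed.bind, Timed.step, Bool.and_eq_true, subsetT_val, Set.ext_iff,
    Set.mem_ofPred_eq]
  exact ⟨fun h x => ⟨h.1 x, h.2 x⟩, fun h => ⟨fun x => (h x).1, fun x => (h x).2⟩⟩

/-- The elements of a list are pairwise incomparable. -/
def Incomparable (l : List (Profile d)) : Prop := l.Pairwise fun x y => ¬ x ≤ y ∧ ¬ y ≤ x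

/-- The upward closed set generated by a list. -/
def gen (l : List (Profile d)) : Set (Profile d) := upward {x | x ∈ l}

theorem mem_gen {l : List (Profile d)} {x : Profile d} : x ∈ gen l ↔ ∃ y ∈ l, y ≤ x := Iff.rfl

/-- This turns equality of generated upward closed sets into equality of the lists as sets. -/
theorem Incomparable.setOf_mem {l : List (Profile d)} (hl : Incomparable l) :
    {x | x ∈ l} = minimals (gen l) := by
  rw [gen, minimals_upward]
  ext x
  refine ⟨fun hx => ⟨hx, fun y hy hyx => ?_⟩, fun hx => hx.1⟩
  by_contra hxy
  have hne : y ≠ x := fun h => hxy h.ge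
  have : Std.Symm fun x y : Profile d => ¬ x ≤ y ∧ ¬ y ≤ x := ⟨fun _ _ h => h.symm⟩
  exact (List.Pairwise.forall hl hy hx hne).1 hyx

theorem mem_insertT_iff {l : List (Profile d)} {x y : Profile d} :
    y ∈ (insertT l x).val ↔
      (∃ z ∈ l, z ≤ x) ∧ y ∈ l ∨ (¬ ∃ z ∈ l, z ≤ x) ∧ (y = x ∨ y ∈ l ∧ ¬ x ≤ y) := by
  have h : ∀ b : Bool, (!b) = true ↔ ¬ b = true := by decide
  simp only [insertT, Timed.bind]
  split_ifs with hb <;> simp only [Timed.any_val, leT_val] at hb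
  · simp [Timed.step, hb]
  · simp only [Timed.step, Timed.filter_val, List.mem_cons, List.mem_filter, h, leT_val]
    simp only [hb, false_and, not_false_eq_true, true_and, false_or]

theorem Incomparable.insertT {l : List (Profile d)} (hl : Incomparable l) (x : Profile d) :
    Incomparable (insertT l x).val := by
  have h : ∀ b : Bool, (!b) = true ↔ ¬ b = true := by decide
  simp only [Profile.insertT, Timed.bind]
  split_ifs with hb <;> simp only [Timed.any_val, leT_val] at hb
  · exact hl
  · simp only [Timed.step, Timed.filter_val]
    refine List.pairwise_cons.2 ⟨fun y hy => ?_, hl.filter _⟩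
    simp only [List.mem_filter, h, leT_val] at hy
    exact ⟨hy.2, fun hyx => hb ⟨y, hy.1, hyx⟩⟩

theorem mem_gen_insertT {l : List (Profile d)} {x z : Profile d} :
    z ∈ gen (insertT l x).val ↔ z ∈ gen l ∨ x ≤ z := by
  simp only [mem_gen, mem_insertT_iff]
  constructor
  · rintro ⟨y, ⟨-, hy⟩ | ⟨-, rfl | ⟨hy, -⟩⟩, hyz⟩
    · exact .inl ⟨y, hy, hyz⟩
    · exact .inr hyz
    · exact .inl ⟨y, hy, hyz⟩
  · by_cases hx : ∃ z ∈ l, z ≤ x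
    · rintro (⟨y, hy, hyz⟩ | hxz)
      · exact ⟨y, .inl ⟨hx, hy⟩, hyz⟩
      · obtain ⟨y, hy, hyx⟩ := hx
        exact ⟨y, .inl ⟨⟨y, hy, hyx⟩, hy⟩, hyx.trans hxz⟩
    · rintro (⟨y, hy, hyz⟩ | hxz)
      · by_cases hxy : x ≤ y
        · exact ⟨x, .inr ⟨hx, .inl rfl⟩, hxy.trans hyz⟩
        · exact ⟨y, .inr ⟨hx, .inr ⟨hy, hxy⟩⟩, hyz⟩
      · exact ⟨x, .inr ⟨hx, .inl rfl⟩, hxz⟩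

theorem incomparable_fold_insertT {l : List (Profile d)} {m : List (Profile d)}
    (hm : Incomparable m) : Incomparable (Timed.fold insertT m l).val := by
  rw [Timed.fold_val]
  induction l generalizing m with
  | nil => exact hm
  | cons a l ih => exact ih (hm.insertT a)

theorem mem_gen_fold_insertT {l m : List (Profile d)} {z : Profile d} :
    z ∈ gen (Timed.fold insertT m l).val ↔ z ∈ gen m ∨ z ∈ gen l := by
  rw [Timed.fold_val]
  induction l generalizing m with
  | nil => simp [mem_gen]
  | cons a l ih =>
    rw [List.foldl_cons, ih, mem_gen_insertT, or_assoc]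
    simp [mem_gen]

theorem mem_of_mem_fold_insertT {l m : List (Profile d)} {z : Profile d}
    (hz : z ∈ (Timed.fold insertT m l).val) : z ∈ m ∨ z ∈ l := by
  rw [Timed.fold_val] at hz
  induction l generalizing m with
  | nil => exact .inl hz
  | cons a l ih =>
    rcases ih hz with h | h
    · rw [mem_insertT_iff] at h
      rw [List.mem_cons]
      tauto
    · exact .inr (List.mem_cons_of_mem a h)

theorem incomparable_minimizeT (l : List (Profile d)) : Incomparable (minimizeT l).val :=
  incomparable_fold_insertT List.Pairwise.nil

theorem gen_minimizeT (l : List (Profile d)) : gen (minimizeT l).val = gen l := by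
  ext z
  rw [minimizeT, mem_gen_fold_insertT]
  simp [mem_gen]

theorem mem_of_mem_minimizeT {l : List (Profile d)} {z : Profile d}
    (hz : z ∈ (minimizeT l).val) : z ∈ l := by
  simpa using mem_of_mem_fold_insertT hz

theorem translateT_val (l : List (Profile d)) (w : Profile d) :
    (translateT l w).val = l.map fun x => x + w := by
  rw [translateT, Timed.map_val]
  rfl

theorem mem_interT {l m : List (Profile d)} {z : Profile d} :
    z ∈ (interT l m).val ↔ ∃ x ∈ l, ∃ y ∈ m, x ⊔ y = z := by
  induction l with
  | nil => simp [interT, Timed.step]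
  | cons a l ih =>
    simp [interT, Timed.bind, Timed.append_val, Timed.map_val, maxT_val, ih]

theorem length_interT (l m : List (Profile d)) :
    (interT l m).val.length = l.length * m.length := by
  induction l with
  | nil => simp [interT, Timed.step]
  | cons a l ih =>
    simp [interT, Timed.bind, Timed.append_val, Timed.map_val, ih, add_mul, add_comm]

/-- A profile is above `x` and `y` iff it is above `x ⊔ y`. -/
theorem gen_interT (l m : List (Profile d)) : gen (interT l m).val = gen l ∩ gen m := by
  ext z
  simp only [mem_gen, mem_interT, Set.mem_inter_iff]
  constructor
  · rintro ⟨_, ⟨x, hx, y, hy, rfl⟩, hz⟩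
    exact ⟨⟨x, hx, le_sup_left.trans hz⟩, ⟨y, hy, le_sup_right.trans hz⟩⟩
  · rintro ⟨⟨x, hx, hxz⟩, ⟨y, hy, hyz⟩⟩
    exact ⟨x ⊔ y, ⟨x, hx, y, hy, rfl⟩, sup_le hxz hyz⟩

theorem gen_append (l m : List (Profile d)) : gen (l ++ m) = gen l ∪ gen m := by
  ext z
  simp [mem_gen, or_and_right, exists_or]

end Profile

/-! ### Correctness of the list computations -/

namespace Game

open Profile

variable {V : Type*} {d : ℕ} (G : Game V d)

theorem gen_translateT (l : List (Profile d)) (v v' : V) :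
    gen (translateT l (G.weightProfile v v')).val = shift (gen l) (G.weightProfile v v') := by
  rw [translateT_val]
  ext z
  constructor
  · rintro ⟨y, hy, hyz⟩
    obtain ⟨x, hx, rfl⟩ := List.mem_map.1 hy
    exact G.mem_shift_of_le ⟨x, ⟨x, hx, le_rfl⟩, rfl⟩ hyz
  · rintro ⟨y, ⟨x, hx, hxy⟩, rfl⟩
    exact ⟨x + G.weightProfile v v', List.mem_map.2 ⟨x, hx, rfl⟩, G.add_weightProfile_le.2 hxy⟩

theorem mem_unionT (s : AlgState V d) (v : V) (l : List V) {x : Profile d} :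
    x ∈ (G.unionT s v l).val ↔ ∃ v' ∈ l, ∃ y ∈ s.I v', y + G.weightProfile v v' = x := by
  induction l with
  | nil => simp [unionT, Timed.step]
  | cons a l ih =>
    simp [unionT, Timed.bind, Timed.step, Timed.append_val, translateT_val, ih]

theorem mem_gen_unionT (s : AlgState V d) (v : V) (l : List V) {x : Profile d} :
    x ∈ gen (G.unionT s v l).val ↔
      ∃ v' ∈ l, x ∈ shift (gen (s.I v')) (G.weightProfile v v') := by
  induction l with
  | nil => simp [unionT, Timed.step, mem_gen]
  | cons a l ih =>
    simp [unionT, Timed.bind, Timed.step, Timed.append_val, gen_append, gen_translateT, ih]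

/-- One step of the successive intersection. -/
noncomputable def interStepT (s : AlgState V d) (v : V) (i : List (Profile d)) (v' : V) :
    Timed (List (Profile d)) :=
  (Timed.step (s.I v')).bind fun b =>
  (Profile.translateT b (G.weightProfile v v')).bind fun j =>
  (Profile.interT i j).bind fun c =>
  Profile.minimizeT c

theorem interAllT_cons (s : AlgState V d) (v u : V) (l : List V) :
    G.interAllT s v (u :: l) = (Timed.step (s.I u)).bind fun a =>
      Timed.fold (G.interStepT s v) a (u :: l) := rfl

theorem incomparable_fold_interStepT (s : AlgState V d) (v : V) (l : List V)
    {i : List (Profile d)} (hi : Incomparable i) :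
    Incomparable (Timed.fold (G.interStepT s v) i l).val := by
  rw [Timed.fold_val]
  induction l generalizing i with
  | nil => exact hi
  | cons a l ih => exact ih (incomparable_minimizeT _)

theorem mem_gen_fold_interStepT (s : AlgState V d) (v : V) (l : List V) {i : List (Profile d)}
    {x : Profile d} : x ∈ gen (Timed.fold (G.interStepT s v) i l).val ↔
      x ∈ gen i ∧ ∀ v' ∈ l, x ∈ shift (gen (s.I v')) (G.weightProfile v v') := by
  rw [Timed.fold_val]
  induction l generalizing i with
  | nil => simp
  | cons a l ih =>
    rw [List.foldl_cons, ih]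
    simp [interStepT, Timed.bind, Timed.step, gen_minimizeT, gen_interT, gen_translateT, and_assoc]

/-- Starting from the untranslated list of the first successor `u` is harmless: weights are
nonnegative, so translating only shrinks an upward closed set, and `u` is processed again in the
loop. -/
theorem mem_gen_interAllT (s : AlgState V d) (v : V) {l : List V} (hl : l ≠ []) {x : Profile d} :
    x ∈ gen (G.interAllT s v l).val ↔
      ∀ v' ∈ l, x ∈ shift (gen (s.I v')) (G.weightProfile v v') := by
  cases l with
  | nil => exact absurd rfl hl
  | cons u l =>
    rw [interAllT_cons]
    simp only [Timed.bind, Timed.step, mem_gen_fold_interStepT, and_iff_right_iff_imp]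
    intro h
    obtain ⟨y, hy, rfl⟩ := h u List.mem_cons_self
    exact mem_upward_of_le hy le_self_add

/-- The arrays of `s` represent the sets `I^k(v)`. -/
structure Represents [DecidableEq V] (s : AlgState V d) (k : ℕ) : Prop where
  setOf_mem : ∀ v, {x | x ∈ s.I v} = G.iter k v
  incomparable : ∀ v, Incomparable (s.I v)
  length_le : ∀ v, (s.f v).length ≤ (s.I v).length

section Algorithm

variable [DecidableEq V] {G}

theorem Represents.gen_eq {s : AlgState V d} {k : ℕ} (h : G.Represents s k) (v : V) :
    gen (s.I v) = upward (G.iter k v) := by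
  rw [gen, h.setOf_mem]

/-- Off the target the computed list is an antichain generating the required union or intersection,
hence lists its minimal elements. -/
theorem Represents.updateIT {s : AlgState V d} {k : ℕ} (h : G.Represents s k) (L : SuccLists G)
    (v : V) : {x | x ∈ (G.updateIT L s v).val} = G.iter (k + 1) v ∧
      Incomparable (G.updateIT L s v).val := by
  by_cases hv : v ∈ G.target
  · have e : (G.updateIT L s v).val = [0] := by
      simp only [Game.updateIT, Timed.bind, Timed.step, hv, decide_true, if_true]
      rfl
    rw [e, G.iter_target hv]
    exact ⟨by simp, List.pairwise_singleton _ _⟩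
  by_cases ho : G.owner v = Player.one
  · have e : (G.updateIT L s v).val = (minimizeT (G.unionT s v (L.succ v)).val).val := by
      simp [Game.updateIT, Timed.bind, Timed.step, hv, ho]
    rw [e, (incomparable_minimizeT _).setOf_mem]
    refine ⟨?_, incomparable_minimizeT _⟩
    rw [gen_minimizeT, iter, if_neg hv, if_pos ho]
    congr 1
    ext x
    simp [mem_gen_unionT, L.mem_succ, h.gen_eq]
  · have e : (G.updateIT L s v).val = (G.interAllT s v (L.succ v)).val := by
      simp [Game.updateIT, Timed.bind, Timed.step, hv, ho]
    have hne : L.succ v ≠ [] := by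
      obtain ⟨v', h⟩ := G.exists_succ v
      exact List.ne_nil_of_mem ((L.mem_succ v v').2 h)
    have hinc : Incomparable (G.interAllT s v (L.succ v)).val := by
      obtain ⟨u, l, e⟩ := List.exists_cons_of_ne_nil hne
      rw [e, interAllT_cons]
      exact G.incomparable_fold_interStepT s v (u :: l) (h.incomparable u)
    rw [e]
    refine ⟨?_, hinc⟩
    rw [hinc.setOf_mem, iter, if_neg hv, if_neg ho]
    congr 1
    ext x
    simp [G.mem_gen_interAllT s v hne, L.mem_succ, h.gen_eq]

variable [Fintype V]

theorem represents_init : G.Represents G.initT.val 0 where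
  setOf_mem v := by
    by_cases hv : v ∈ G.target <;>
    · simp [initT, Timed.bind, Timed.step, Timed.fill, Timed.pure, constT, iter, hv]
      rfl
  incomparable v := List.pairwise_singleton _ _
  length_le v := Nat.zero_le _

theorem Represents.roundT {s : AlgState V d} {k : ℕ} (h : G.Represents s k) (L : SuccLists G) :
    G.Represents (G.roundT L s).val.1 (k + 1) where
  setOf_mem v := (h.updateIT L v).1
  incomparable v := (h.updateIT L v).2
  -- Each new generator contributes at most one pair. Only this length matters, for the cost of a
  -- lookup.
  length_le v := by
    have hl : (G.updateFT L s v (G.updateIT L s v).val).val.length ≤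
        (G.updateIT L s v).val.length := by
      simp only [updateFT, Timed.bind]
      split_ifs
      · exact Timed.length_collect_le _ _
      · exact Nat.zero_le _
    exact hl

theorem represents_stateAfter (L : SuccLists G) (k : ℕ) : G.Represents (G.stateAfter L k) k := by
  induction k with
  | zero => exact represents_init
  | succ k ih =>
    rw [stateAfter, Function.iterate_succ_apply']
    exact ih.roundT L

theorem Represents.roundT_flag {s : AlgState V d} {k : ℕ} (h : G.Represents s k)
    (L : SuccLists G) :
    (G.roundT L s).val.2 = true ↔ ∀ v, G.iter (k + 1) v = G.iter k v := by
  have e : (G.roundT L s).val.2 = true ↔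
      ∀ v, (sameT (G.updateIT L s v).val (s.I v)).val = true := by
    simp [Game.roundT, Timed.bind, Timed.pure, Timed.fill, Timed.allIdx]
  simp only [e, sameT_val, (h.updateIT L _).1, h.setOf_mem]

end Algorithm

end Game

/-! ### Running times -/

namespace Timed

variable {α β σ ι : Type*}

theorem any_time {p : α → Timed Bool} {l : List α} {c : ℕ} (h : ∀ a ∈ l, (p a).time ≤ c) :
    (any p l).time ≤ l.length * (c + 1) + 1 := by
  induction l with
  | nil => simp [any, step]
  | cons a l ih =>
    have h1 := h a List.mem_cons_self
    have h2 := ih fun b hb => h b (List.mem_cons_of_mem a hb)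
    simp only [any, bind, List.length_cons, add_mul]
    split_ifs <;> simp only [step] <;> lia

theorem map_time {f : α → Timed β} {l : List α} {c : ℕ} (h : ∀ a ∈ l, (f a).time ≤ c) :
    (map f l).time ≤ l.length * (c + 1) + 1 := by
  induction l with
  | nil => simp [map, step]
  | cons a l ih =>
    have h1 := h a List.mem_cons_self
    have h2 := ih fun b hb => h b (List.mem_cons_of_mem a hb)
    simp only [map, bind, step, List.length_cons, add_mul]
    lia

theorem filter_time {p : α → Timed Bool} {l : List α} {c : ℕ} (h : ∀ a ∈ l, (p a).time ≤ c) :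
    (filter p l).time ≤ l.length * (c + 1) + 1 := by
  induction l with
  | nil => simp [filter, step]
  | cons a l ih =>
    have h1 := h a List.mem_cons_self
    have h2 := ih fun b hb => h b (List.mem_cons_of_mem a hb)
    simp only [filter, bind, List.length_cons, add_mul]
    split_ifs <;> simp only [step] <;> lia

theorem findSome_time {f : α → Timed (Option β)} {l : List α} {c : ℕ}
    (h : ∀ a ∈ l, (f a).time ≤ c) : (findSome f l).time ≤ l.length * (c + 1) + 1 := by
  induction l with
  | nil => simp [findSome, step]
  | cons a l ih =>
    have h1 := h a List.mem_cons_self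
    have h2 := ih fun b hb => h b (List.mem_cons_of_mem a hb)
    simp only [findSome, bind, List.length_cons, add_mul]
    cases (f a).val <;> simp only [step] <;> lia

theorem collect_time {f : α → Timed (Option β)} {l : List α} {c : ℕ}
    (h : ∀ a ∈ l, (f a).time ≤ c) : (collect f l).time ≤ l.length * (c + 1) + 1 := by
  induction l with
  | nil => simp [collect, step]
  | cons a l ih =>
    have h1 := h a List.mem_cons_self
    have h2 := ih fun b hb => h b (List.mem_cons_of_mem a hb)
    simp only [collect, bind, List.length_cons, add_mul]
    cases (f a).val <;> simp only [step] <;> lia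

theorem append_time (l m : List α) : (append l m).time = l.length + 1 := by
  induction l with
  | nil => rfl
  | cons a l ih => simp [append, bind, step, ih]

/-- The cost of the body depends on the loop variable, so the uniform bound `c` is required only
under an invariant. -/
theorem fold_time {f : σ → α → Timed σ} (Inv : σ → Prop) {l : List α} {s : σ} {c : ℕ}
    (hs : Inv s) (h : ∀ s, Inv s → ∀ a ∈ l, (f s a).time ≤ c ∧ Inv (f s a).val) :
    (fold f s l).time ≤ l.length * (c + 1) + 1 := by
  induction l generalizing s with
  | nil => simp [fold, step]
  | cons a l ih =>
    have h1 := h s hs a List.mem_cons_self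
    have h2 := ih h1.2 fun s hs b hb => h s hs b (List.mem_cons_of_mem a hb)
    simp only [fold, bind, step, List.length_cons, add_mul]
    lia

theorem fill_time [Fintype ι] {f : ι → Timed α} {c : ℕ} (h : ∀ i, (f i).time ≤ c) :
    (fill f).time ≤ Fintype.card ι * (c + 1) :=
  Finset.sum_le_card_nsmul _ _ _ fun i _ => Nat.succ_le_succ (h i)

theorem allIdx_time [Fintype ι] {f : ι → Timed Bool} {c : ℕ} (h : ∀ i, (f i).time ≤ c) :
    (allIdx f).time ≤ Fintype.card ι * (c + 1) :=
  Finset.sum_le_card_nsmul _ _ _ fun i _ => Nat.succ_le_succ (h i)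

/-- There are at most `n + 1` executions, each followed by one test of the flag. The index `j` of
the final execution is kept, since its flag is what certifies the result. -/
theorem exists_repeatUntil {body : σ → Timed (σ × Bool)} {T : ℕ} (n : ℕ) (s : σ)
    (h : ∃ j ≤ n, (body ((fun s => (body s).val.1)^[j] s)).val.2 = true)
    (hT : ∀ j ≤ n, (body ((fun s => (body s).val.1)^[j] s)).time ≤ T) :
    ∃ j, (body ((fun s => (body s).val.1)^[j] s)).val.2 = true ∧ ∃ t ≤ (n + 1) * (T + 1),
      RepeatUntil body s ((fun s => (body s).val.1)^[j + 1] s) t := by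
  induction n generalizing s with
  | zero =>
    obtain ⟨j, hj, hf⟩ := h
    obtain rfl : j = 0 := by lia
    have := hT 0 le_rfl
    exact ⟨0, hf, (body s).time + 1, by simpa using this, .done s hf⟩
  | succ n ih =>
    have h0 : (body s).time ≤ T := hT 0 (Nat.zero_le _)
    by_cases hs : (body s).val.2 = true
    · refine ⟨0, hs, (body s).time + 1, ?_, .done s hs⟩
      rw [add_mul]
      lia
    · obtain ⟨j, hf, t, ht, hr⟩ := ih (body s).val.1 (by
        obtain ⟨j, hj, hf⟩ := h
        cases j with
        | zero => exact absurd hf hs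
        | succ j => exact ⟨j, by lia, hf⟩) fun j hj => hT (j + 1) (by lia)
      refine ⟨j + 1, hf, (body s).time + 1 + t, ?_, .again s _ t (by simpa using hs) hr⟩
      rw [add_mul (n + 1)]
      lia

end Timed

/-! ### Running times of the operations on generators -/

namespace Profile

variable {d : ℕ}

theorem leT_time (x y : Profile d) : (leT x y).time = 2 * d := by
  simp [leT, Timed.allIdx, Timed.step, mul_comm]

theorem eqT_time (x y : Profile d) : (eqT x y).time = 2 * d := by
  simp [eqT, Timed.allIdx, Timed.step, mul_comm]

theorem addT_time (x y : Profile d) : (addT x y).time = 2 * d := by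
  simp [addT, Timed.fill, Timed.step, mul_comm]

theorem maxT_time (x y : Profile d) : (maxT x y).time = 2 * d := by
  simp [maxT, Timed.fill, Timed.step, mul_comm]

theorem constT_time (c : ℕ∞) : (constT c : Timed (Profile d)).time = 2 * d := by
  simp [constT, Timed.fill, Timed.step, mul_comm]

/-- A set of cost profiles that is closed under maxima and has no antichain of more than `M`
elements. -/
structure Narrow (P : Set (Profile d)) (M : ℕ) : Prop where
  sup_mem : ∀ x ∈ P, ∀ y ∈ P, x ⊔ y ∈ P
  length_le : ∀ l : List (Profile d), Incomparable l → (∀ x ∈ l, x ∈ P) → l.length ≤ M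

section

variable {M : ℕ} (hd : 1 ≤ d) (hM : 1 ≤ M)

include hd hM

theorem memT_time {l : List (Profile d)} (hl : l.length ≤ M) (x : Profile d) :
    (memT x l).time ≤ 4 * (d * M) := by
  have h : (memT x l).time ≤ l.length * (2 * d + 1) + 1 :=
    Timed.any_time fun a _ => (eqT_time a x).le
  have h1 := Nat.mul_le_mul_right (2 * d + 1) hl
  have h2 : M ≤ d * M := Nat.le_mul_of_pos_left M hd
  nlinarith

theorem subsetT_time {l m : List (Profile d)} (hl : l.length ≤ M) (hm : m.length ≤ M) :
    (subsetT l m).time ≤ 8 * (d * M ^ 2) := by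
  have h : (subsetT l m).time ≤ l.length * (4 * (d * M) + 1 + 1) + 1 + 1 := by
    refine Nat.succ_le_succ (Timed.any_time fun a _ => ?_)
    exact Nat.succ_le_succ (memT_time hd hM hm a)
  have h1 := Nat.mul_le_mul_right (4 * (d * M) + 1 + 1) hl
  have h2 : M ≤ d * M := Nat.le_mul_of_pos_left M hd
  have h3 : d * M ≤ d * M ^ 2 := Nat.mul_le_mul_left d (Nat.le_self_pow two_ne_zero M)
  linarith

theorem sameT_time {l m : List (Profile d)} (hl : l.length ≤ M) (hm : m.length ≤ M) :
    (sameT l m).time ≤ 17 * (d * M ^ 2) := by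
  have h : (sameT l m).time = (subsetT l m).time + ((subsetT m l).time + 1) := rfl
  have h1 := subsetT_time hd hM hl hm
  have h2 := subsetT_time hd hM hm hl
  have h3 : 1 ≤ d * M ^ 2 := Nat.mul_pos hd (Nat.pow_pos hM)
  lia

theorem insertT_time {l : List (Profile d)} (hl : l.length ≤ M) (x : Profile d) :
    (insertT l x).time ≤ 10 * (d * M) := by
  have h1 : (Timed.any (fun y => leT y x) l).time ≤ l.length * (2 * d + 1) + 1 :=
    Timed.any_time fun a _ => (leT_time a x).le
  have h2 : (Timed.filter (fun y => (leT x y).bind fun c => Timed.step (!c)) l).time ≤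
      l.length * (2 * d + 1 + 1) + 1 :=
    Timed.filter_time fun a _ => Nat.succ_le_succ (leT_time x a).le
  have h3 := Nat.mul_le_mul_right (2 * d + 1) hl
  have h4 : M ≤ d * M := Nat.le_mul_of_pos_left M hd
  have h5 := Nat.mul_le_mul_right (2 * d + 1 + 1) hl
  simp only [insertT, Timed.bind] at h2 ⊢
  split_ifs <;> simp only [Timed.step] at h2 ⊢ <;> nlinarith

theorem translateT_time {l : List (Profile d)} (hl : l.length ≤ M) (w : Profile d) :
    (translateT l w).time ≤ 4 * (d * M) := by
  have h : (translateT l w).time ≤ l.length * (2 * d + 1) + 1 :=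
    Timed.map_time fun a _ => (addT_time a w).le
  have h1 := Nat.mul_le_mul_right (2 * d + 1) hl
  have h2 : M ≤ d * M := Nat.le_mul_of_pos_left M hd
  nlinarith

theorem interT_time {l m : List (Profile d)} (hl : l.length ≤ M) (hm : m.length ≤ M) :
    (interT l m).time ≤ 7 * (d * M ^ 2) := by
  have h : (interT l m).time ≤ l.length * (M * (2 * d + 2) + 2) + 1 := by
    clear hl
    induction l with
    | nil => simp [interT, Timed.step]
    | cons x l ih =>
      have h1 : (Timed.map (fun y => maxT x y) m).time ≤ m.length * (2 * d + 1) + 1 :=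
        Timed.map_time fun a _ => (maxT_time x a).le
      have h2 := Nat.mul_le_mul_right (2 * d + 1) hm
      simp only [interT, Timed.bind, Timed.append_time, Timed.map_val, List.length_map,
        List.length_cons]
      nlinarith
  have h1 := Nat.mul_le_mul_right (M * (2 * d + 2) + 2) hl
  have h2 : M ^ 2 ≤ d * M ^ 2 := Nat.le_mul_of_pos_left _ hd
  have h3 : M ≤ M ^ 2 := Nat.le_self_pow two_ne_zero M
  nlinarith

/-- However long the input, the accumulated list is an antichain in `P`, so each insertion works on
at most `M` elements. -/
theorem minimizeT_time {P : Set (Profile d)} (hP : Narrow P M) {l : List (Profile d)}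
    (hl : ∀ x ∈ l, x ∈ P) : (minimizeT l).time ≤ l.length * (11 * (d * M)) + 1 := by
  have h : (minimizeT l).time ≤ l.length * (10 * (d * M) + 1) + 1 := by
    refine Timed.fold_time (fun m => Incomparable m ∧ ∀ x ∈ m, x ∈ P)
      ⟨List.Pairwise.nil, by simp⟩ fun m hm x hx => ⟨?_, hm.1.insertT x, fun y hy => ?_⟩
    · exact insertT_time hd hM (hP.length_le m hm.1 hm.2) x
    · rw [mem_insertT_iff] at hy
      rcases hy with ⟨-, hy⟩ | ⟨-, rfl | ⟨hy, -⟩⟩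
      · exact hm.2 y hy
      · exact hl y hx
      · exact hm.2 y hy
  have h2 : 1 ≤ d * M := Nat.mul_pos hd hM
  have h3 : l.length * (10 * (d * M) + 1) ≤ l.length * (11 * (d * M)) :=
    Nat.mul_le_mul_left _ (by lia)
  lia

end

end Profile

/-! ### Running times of one round and of the whole algorithm -/

namespace Game

open Profile

variable {V : Type*} {d : ℕ} {G : Game V d}

theorem SuccLists.length_le [Fintype V] (L : SuccLists G) (v : V) :
    (L.succ v).length ≤ Fintype.card V := (L.nodup v).length_le_card

theorem initT_time [DecidableEq V] [Fintype V] (hd : 1 ≤ d) : G.initT.time ≤ 7 * (Fintype.card V * d) := by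
  have h : (G.initT).time ≤ Fintype.card V * (1 + (2 * d + 1) + 1) +
      (Fintype.card V * (1 + 1) + 0) := by
    refine Nat.add_le_add (Timed.fill_time fun v => ?_)
      (Nat.add_le_add (Timed.fill_time fun v => le_rfl) le_rfl)
    simp only [Timed.bind, Timed.step, constT_time, le_refl]
  have h1 : Fintype.card V ≤ Fintype.card V * d := Nat.le_mul_of_pos_right _ hd
  nlinarith

/-- All cost profiles that occur in an iteration started with `s` lie in `P`. -/
structure Confined (G : Game V d) (s : AlgState V d) (P : Set (Profile d)) : Prop where
  mem : ∀ v, ∀ x ∈ s.I v, x ∈ P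
  add_mem : ∀ v ∉ G.target, ∀ v', G.edge v v' → ∀ x ∈ s.I v', x + G.weightProfile v v' ∈ P

section Round

variable {M : ℕ} {P : Set (Profile d)} {s : AlgState V d} (hd : 1 ≤ d) (hM : 1 ≤ M)
  (hP : Narrow P M) (hs : G.Confined s P)

include hd hM

theorem unionT_time (hI : ∀ v, (s.I v).length ≤ M) (v : V) (l : List V) :
    (G.unionT s v l).time ≤ l.length * (7 * (d * M)) + 1 ∧
      (G.unionT s v l).val.length ≤ l.length * M := by
  induction l with
  | nil => simp [unionT, Timed.step]
  | cons a l ih =>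
    have h1 := translateT_time hd hM (hI a) (G.weightProfile v a)
    have h2 : M ≤ d * M := Nat.le_mul_of_pos_left M hd
    have h3 := hI a
    simp only [unionT, Timed.bind, Timed.step, Timed.append_val, Timed.append_time,
      translateT_val, List.length_map, List.length_cons, List.length_append, add_mul] at h1 ⊢
    constructor <;> lia

include hP hs

/-- Minimizing after each successor brings the `M ^ 2` maxima back to at most `M`, so lengths do not
multiply. Closure of `P` under maxima is used here. -/
theorem interAllT_time (hI : ∀ v, Incomparable (s.I v)) {v : V} (hv : v ∉ G.target)
    {l : List V} (hl : ∀ v' ∈ l, G.edge v v') :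
    (G.interAllT s v l).time ≤ l.length * (25 * (d * M ^ 3)) + 2 := by
  have hlen : ∀ u, (s.I u).length ≤ M := fun u => hP.length_le _ (hI u) (hs.mem u)
  cases l with
  | nil => simp [interAllT, Timed.step]
  | cons u l =>
    have h : (Timed.fold (G.interStepT s v) (s.I u) (u :: l)).time ≤
        (u :: l).length * (24 * (d * M ^ 3) + 1) + 1 := by
      refine Timed.fold_time (fun i => Incomparable i ∧ ∀ x ∈ i, x ∈ P)
        ⟨hI u, hs.mem u⟩ fun i hi v' hv' => ?_
      have hi' := hP.length_le i hi.1 hi.2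
      have hj : (translateT (s.I v') (G.weightProfile v v')).val.length ≤ M := by
        simpa [translateT_val] using hlen v'
      have hmem : ∀ x ∈ (interT i (translateT (s.I v') (G.weightProfile v v')).val).val,
          x ∈ P := by
        intro x hx
        obtain ⟨y, hy, z, hz, rfl⟩ := mem_interT.1 hx
        rw [translateT_val] at hz
        obtain ⟨z', hz', rfl⟩ := List.mem_map.1 hz
        exact hP.sup_mem _ (hi.2 y hy) _ (hs.add_mem v hv v' (hl v' hv') z' hz')
      refine ⟨?_, incomparable_minimizeT _, fun x hx => hmem x (mem_of_mem_minimizeT hx)⟩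
      have h1 := translateT_time hd hM (hlen v') (G.weightProfile v v')
      have h2 := interT_time hd hM hi' hj
      have h3 := minimizeT_time hd hM hP hmem
      rw [length_interT] at h3
      have h4 := Nat.mul_le_mul_right (11 * (d * M)) (Nat.mul_le_mul hi' hj)
      have h5 : d * M ≤ d * M ^ 3 := Nat.mul_le_mul_left d (Nat.le_self_pow three_ne_zero M)
      have h6 : d * M ^ 2 ≤ d * M ^ 3 :=
        Nat.mul_le_mul_left d (Nat.pow_le_pow_right hM (by lia))
      have h7 : 1 ≤ d * M ^ 3 := Nat.mul_pos hd (Nat.pow_pos hM)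
      have e : M * M * (11 * (d * M)) = 11 * (d * M ^ 3) := by ring
      simp only [interStepT, Timed.bind, Timed.step]
      lia
    have h7 : 1 ≤ d * M ^ 3 := Nat.mul_pos hd (Nat.pow_pos hM)
    have h8 : (u :: l).length * (24 * (d * M ^ 3) + 1) ≤ (u :: l).length * (25 * (d * M ^ 3)) :=
      Nat.mul_le_mul_left _ (by lia)
    rw [interAllT_cons]
    simp only [Timed.bind, Timed.step] at h ⊢
    lia

variable [DecidableEq V] [Fintype V] (L : SuccLists G)

theorem updateIT_time (hI : ∀ v, Incomparable (s.I v)) (v : V) :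
    (G.updateIT L s v).time ≤ 29 * (Fintype.card V * (d * M ^ 3)) := by
  have hlen : ∀ u, (s.I u).length ≤ M := fun u => hP.length_le _ (hI u) (hs.mem u)
  have hn : 1 ≤ Fintype.card V := Fintype.card_pos_iff.2 ⟨v⟩
  have hL := SuccLists.length_le L v
  have hdM : d ≤ d * M ^ 3 := Nat.le_mul_of_pos_right d (Nat.pow_pos hM)
  have h0 : d * M ^ 3 ≤ Fintype.card V * (d * M ^ 3) := Nat.le_mul_of_pos_left _ hn
  by_cases hv : v ∈ G.target
  · simp only [updateIT, Timed.bind, Timed.step, hv, decide_true, if_true, constT_time]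
    lia
  by_cases ho : G.owner v = Player.one
  · have h1 := unionT_time hd hM hlen v (L.succ v) (G := G)
    have h2 : (minimizeT (G.unionT s v (L.succ v)).val).time ≤ _ :=
      minimizeT_time hd hM hP fun x hx => by
        obtain ⟨v', hv', y, hy, rfl⟩ := (G.mem_unionT s v _).1 hx
        exact hs.add_mem v hv v' ((L.mem_succ v v').1 hv') y hy
    have h3 : (G.unionT s v (L.succ v)).val.length ≤ Fintype.card V * M :=
      h1.2.trans (Nat.mul_le_mul_right M hL)
    have h4 := Nat.mul_le_mul_right (11 * (d * M)) h3
    have h5 := Nat.mul_le_mul_right (7 * (d * M)) hL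
    have h6 : Fintype.card V * (d * M) ≤ Fintype.card V * (d * M ^ 3) :=
      Nat.mul_le_mul_left _ (Nat.mul_le_mul_left d (Nat.le_self_pow three_ne_zero M))
    have h7 : Fintype.card V * (d * M ^ 2) ≤ Fintype.card V * (d * M ^ 3) :=
      Nat.mul_le_mul_left _ (Nat.mul_le_mul_left d (Nat.pow_le_pow_right hM (by lia)))
    have e1 : Fintype.card V * M * (11 * (d * M)) = 11 * (Fintype.card V * (d * M ^ 2)) := by ring
    have e2 : Fintype.card V * (7 * (d * M)) = 7 * (Fintype.card V * (d * M)) := by ring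
    simp only [updateIT, Timed.bind, Timed.step, hv, ho, decide_true, decide_false, if_true,
      Bool.false_eq_true, if_false]
    lia
  · have h1 := interAllT_time hd hM hP hs hI hv (l := L.succ v) fun v' h => (L.mem_succ v v').1 h
    have h2 := Nat.mul_le_mul_right (25 * (d * M ^ 3)) hL
    have e : Fintype.card V * (25 * (d * M ^ 3)) = 25 * (Fintype.card V * (d * M ^ 3)) := by ring
    simp only [updateIT, Timed.bind, Timed.step, hv, ho, decide_false, Bool.false_eq_true,
      if_false]
    lia

omit hP hs

/-- Each of at most `M` new profiles needs at worst a scan of `|V|` lists of length `M`. -/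
theorem updateFT_time (hI : ∀ v, (s.I v).length ≤ M) (hf : ∀ v, (s.f v).length ≤ M) (v : V)
    {new : List (Profile d)} (hnew : new.length ≤ M) :
    (G.updateFT L s v new).time ≤ 18 * (Fintype.card V * (d * M ^ 3)) := by
  have hn : 1 ≤ Fintype.card V := Fintype.card_pos_iff.2 ⟨v⟩
  have hM' : M ≤ d * M := Nat.le_mul_of_pos_left M hd
  have hdM : d * M ≤ Fintype.card V * (d * M) := Nat.le_mul_of_pos_left _ hn
  have hlook : ∀ x, (lookupT s v x).time ≤ 5 * (d * M) := by
    intro x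
    have h : (lookupT s v x).time ≤ (s.f v).length * (2 * d + 1 + 1) + 1 :=
      Timed.findSome_time fun a _ => Nat.succ_le_succ (eqT_time a.1 x).le
    have h1 := Nat.mul_le_mul_right (2 * d + 1 + 1) (hf v)
    nlinarith
  have hsearch : ∀ x, (G.searchT L s v x).time ≤ 10 * (Fintype.card V * (d * M)) := by
    intro x
    have h : (G.searchT L s v x).time ≤ (L.succ v).length * (8 * (d * M) + 1) + 1 := by
      refine Timed.findSome_time fun v' _ => ?_
      have h : (Timed.findSome (fun x' => (Profile.addT x' (G.weightProfile v v')).bind fun y =>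
          (Profile.eqT y x).bind fun b =>
          Timed.step (if b then some (v', x') else none)) (s.I v')).time ≤
          (s.I v').length * (2 * d + (2 * d + 1) + 1) + 1 :=
        Timed.findSome_time fun a _ => by
          simp only [Timed.bind, Timed.step, addT_time, eqT_time, le_refl]
      have h1 := Nat.mul_le_mul_right (2 * d + (2 * d + 1) + 1) (hI v')
      nlinarith
    have h1 := Nat.mul_le_mul_right (8 * (d * M) + 1) (SuccLists.length_le L v)
    have h2 : Fintype.card V ≤ Fintype.card V * (d * M) :=
      Nat.le_mul_of_pos_right _ (Nat.mul_pos hd hM)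
    nlinarith
  simp only [updateFT, Timed.bind]
  have h3 : Fintype.card V * (d * M ^ 2) ≤ Fintype.card V * (d * M ^ 3) :=
    Nat.mul_le_mul_left _ (Nat.mul_le_mul_left d (Nat.pow_le_pow_right hM (by lia)))
  have h4 : 1 ≤ Fintype.card V * (d * M ^ 2) :=
    Nat.mul_pos hn (Nat.mul_pos hd (Nat.pow_pos hM))
  split_ifs with hb
  · have h := Timed.collect_time (l := new) (f := fun x => (Profile.memT x (s.I v)).bind fun old =>
        (if old then lookupT s v x else G.searchT L s v x).bind fun r =>
        Timed.step (r.map fun p => (x, p))) (c := 15 * (Fintype.card V * (d * M))) (by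
      intro x _
      have h1 := memT_time hd hM (hI v) x
      have h2 := hlook x
      have h3 := hsearch x
      simp only [Timed.bind]
      split_ifs <;> simp only [Timed.step] <;> lia)
    have h1 := Nat.mul_le_mul_right (15 * (Fintype.card V * (d * M)) + 1) hnew
    have h2 : M * (15 * (Fintype.card V * (d * M)) + 1) ≤ 16 * (Fintype.card V * (d * M ^ 2)) := by
      calc M * (15 * (Fintype.card V * (d * M)) + 1)
          ≤ M * (16 * (Fintype.card V * (d * M))) := Nat.mul_le_mul_left M (by lia)
        _ = 16 * (Fintype.card V * (d * M ^ 2)) := by ring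
    simp only [Timed.bind, Timed.step] at h ⊢
    lia
  · simp only [Timed.step]
    lia

include hP hs

theorem roundT_time {k : ℕ} (h : G.Represents s k)
    (hmem : ∀ v, ∀ x ∈ (G.updateIT L s v).val, x ∈ P) :
    (G.roundT L s).time ≤ 67 * (Fintype.card V ^ 2 * (d * M ^ 3)) := by
  have hlen : ∀ u, (s.I u).length ≤ M := fun u => hP.length_le _ (h.incomparable u) (hs.mem u)
  have hlen' : ∀ u, (G.updateIT L s u).val.length ≤ M :=
    fun u => hP.length_le _ (h.updateIT L u).2 (hmem u)
  have h1 : (G.roundT L s).time ≤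
      Fintype.card V * (29 * (Fintype.card V * (d * M ^ 3)) + 1) +
      (Fintype.card V * (18 * (Fintype.card V * (d * M ^ 3)) + 1) +
      (Fintype.card V * (17 * (d * M ^ 2) + 1) + 0)) := by
    refine Nat.add_le_add (Timed.fill_time fun v => ?_)
      (Nat.add_le_add (Timed.fill_time fun v => ?_)
        (Nat.add_le_add (Timed.allIdx_time fun v => ?_) le_rfl))
    · exact updateIT_time hd hM hP hs L h.incomparable v
    · exact updateFT_time hd hM L hlen (fun v => (h.length_le v).trans (hlen v)) v (hlen' v)
    · exact sameT_time hd hM (hlen' v) (hlen v)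
  have h2 : d * M ^ 2 ≤ d * M ^ 3 := Nat.mul_le_mul_left d (Nat.pow_le_pow_right hM (by lia))
  have h3 : 1 ≤ d * M ^ 3 := Nat.mul_pos hd (Nat.pow_pos hM)
  generalize d * M ^ 3 = A at *
  generalize d * M ^ 2 = B at *
  have h4 : Fintype.card V * B ≤ Fintype.card V * A := Nat.mul_le_mul_left _ h2
  have h5 : Fintype.card V * A ≤ Fintype.card V ^ 2 * A :=
    Nat.mul_le_mul_right A (Nat.le_self_pow two_ne_zero _)
  have h6 : Fintype.card V ≤ Fintype.card V * A := Nat.le_mul_of_pos_right _ h3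
  nlinarith

end Round

theorem exists_fixpointAlgorithm [DecidableEq V] [Fintype V] [Nonempty V] {M : ℕ}
    {P : Set (Profile d)} (hd : 1 ≤ d) (hM : 1 ≤ M) (hP : Narrow P M)
    (hmem : ∀ k v, ∀ x ∈ G.iter k v, x ∈ P)
    (hadd : ∀ k, ∀ v ∉ G.target, ∀ v', G.edge v v' → ∀ x ∈ G.iter k v',
      x + G.weightProfile v v' ∈ P) (L : SuccLists G) :
    ∃ (s : AlgState V d) (t : ℕ), G.FixpointAlgorithm L s t ∧
      (∀ v : V, {x | x ∈ s.I v} = G.pareto v) ∧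
      t ≤ 75 * (Fintype.card V ^ 3 * (d * M ^ 3)) := by
  have hn : 1 ≤ Fintype.card V := Fintype.card_pos
  have mem_iff : ∀ k v x, x ∈ (G.stateAfter L k).I v ↔ x ∈ G.iter k v := fun k v x =>
    Set.ext_iff.1 ((represents_stateAfter L k).setOf_mem v) x
  have mem_iff' : ∀ k v x, x ∈ (G.updateIT L (G.stateAfter L k) v).val ↔ x ∈ G.iter (k + 1) v :=
    fun k v x => Set.ext_iff.1 ((represents_stateAfter L k).updateIT L v).1 x
  -- The flag is certainly raised in the round that compares steps `|V| - 1` and `|V|`. It may be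
  -- raised earlier, which is harmless, because a repetition already gives the limit.
  obtain ⟨j, hj, t, ht, hr⟩ := Timed.exists_repeatUntil (body := G.roundT L)
    (T := 67 * (Fintype.card V ^ 2 * (d * M ^ 3))) (Fintype.card V - 1) G.initT.val
    ⟨Fintype.card V - 1, le_rfl, ((represents_stateAfter L _).roundT_flag L).2
      fun v => G.iter_eq_of_card_le (by lia) v⟩ fun k _ => by
      refine roundT_time hd hM hP (s := G.stateAfter L k) ⟨fun v x hx => ?_, ?_⟩ L
        (represents_stateAfter L k) fun v x hx => ?_
      · exact hmem k v x ((mem_iff k v x).1 hx)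
      · exact fun v hv v' he x hx => hadd k v hv v' he x ((mem_iff k v' x).1 hx)
      · exact hmem (k + 1) v x ((mem_iff' k v x).1 hx)
  have hstable := ((represents_stateAfter L j).roundT_flag L).1 hj
  refine ⟨G.stateAfter L (j + 1), _, ⟨t, hr, rfl⟩, fun v => ?_, ?_⟩
  · rw [(represents_stateAfter L (j + 1)).setOf_mem, G.pareto_eq_iter,
      G.iter_card_eq_of_stable hstable]
  · have h1 := initT_time (G := G) hd
    rw [Nat.sub_add_cancel hn] at ht
    have h2 : Fintype.card V * d ≤ Fintype.card V ^ 3 * (d * M ^ 3) :=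
      Nat.mul_le_mul (Nat.le_self_pow three_ne_zero _)
        (Nat.le_mul_of_pos_right d (Nat.pow_pos hM))
    have h3 : Fintype.card V ≤ Fintype.card V ^ 3 * (d * M ^ 3) :=
      (Nat.le_mul_of_pos_right _ hd).trans h2
    have e : Fintype.card V * (67 * (Fintype.card V ^ 2 * (d * M ^ 3)) + 1) =
      67 * (Fintype.card V ^ 3 * (d * M ^ 3)) + Fintype.card V := by ring
    lia

end Game

/-! ### Size of the sets of generators -/

namespace Profile

variable {d : ℕ}

/-- The cost profiles with components at most `B`, together with the infinite one. -/
def box (d B : ℕ) : Set (Profile d) := {x | x = ⊤ ∨ ∀ i, x i ≤ B}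

/-- An antichain containing `⊤` has one element; any other consists of distinct points of `{0, ...,
B} ^ d`. -/
theorem narrow_box (B : ℕ) : Narrow (box d B) ((B + 1) ^ d) where
  sup_mem := by
    rintro x (rfl | hx) y (rfl | hy)
    · exact .inl (sup_idem _)
    · exact .inl (top_sup_eq _)
    · exact .inl (sup_top_eq _)
    · exact .inr fun i => sup_le (hx i) (hy i)
  length_le l hl hP := by
    classical
    by_cases ht : ⊤ ∈ l
    · have hlen : l.length ≤ 1 := by
        obtain ⟨l₁, l₂, rfl⟩ := List.append_of_mem ht
        have h := List.pairwise_append.1 hl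
        have h2 : l₂ = [] := List.eq_nil_iff_forall_not_mem.2 fun x hx =>
          ((List.pairwise_cons.1 h.2.1).1 x hx).2 le_top
        have h1 : l₁ = [] := List.eq_nil_iff_forall_not_mem.2 fun x hx =>
          (h.2.2 x hx ⊤ List.mem_cons_self).1 le_top
        simp [h1, h2]
      exact hlen.trans (Nat.one_le_pow _ _ (Nat.succ_pos B))
    · have hnodup : l.Nodup := hl.imp fun h e => h.1 e.le
      have hsub : l.toFinset ⊆ Fintype.piFinset fun _ : Fin d =>
          (Finset.range (B + 1)).image fun n : ℕ => (n : ℕ∞) := by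
        intro x hx
        rw [List.mem_toFinset] at hx
        have hxB : ∀ i, x i ≤ B := (hP x hx).resolve_left fun h => ht (h ▸ hx)
        rw [Fintype.mem_piFinset]
        intro i
        obtain ⟨n, hn⟩ := ENat.ne_top_iff_exists.1 (ne_top_of_le_ne_top
          (ENat.natCast_ne_top B) (hxB i))
        have := hxB i
        rw [← hn, Nat.cast_le] at this
        exact Finset.mem_image.2 ⟨n, Finset.mem_range.2 (Nat.lt_succ_of_le this), hn⟩
      rw [← List.toFinset_card_of_nodup hnodup]
      refine (Finset.card_le_card hsub).trans ?_
      rw [Fintype.card_piFinset_const]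
      refine Nat.pow_le_pow_left (Finset.card_image_le.trans ?_) d
      rw [Finset.card_range]

theorem narrow_of_chain {P : Set (Profile d)} (h : ∀ x ∈ P, ∀ y ∈ P, x ≤ y ∨ y ≤ x) :
    Narrow P 1 where
  sup_mem x hx y hy := by
    rcases h x hx y hy with hxy | hxy
    · rwa [sup_of_le_right hxy]
    · rwa [sup_of_le_left hxy]
  length_le l hl hP := by
    match l, hl, hP with
    | [], _, _ => exact Nat.zero_le _
    | [_], _, _ => exact le_rfl
    | x :: y :: l, hl, hP =>
      have := (List.pairwise_cons.1 hl).1 y List.mem_cons_self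
      rcases h x (hP x (by simp)) y (hP y (by simp)) with hxy | hxy
      · exact absurd hxy this.1
      · exact absurd hxy this.2

end Profile

/-! ### Where the computed profiles lie: a box in general, a chain for at most two vertices -/

namespace Game

open Profile

variable {V : Type*} {d : ℕ} (G : Game V d) [Fintype V]

theorem weight_le_maxWeight {v v' : V} (h : G.edge v v') (i : Fin d) :
    G.weight v v' i ≤ G.maxWeight := by
  classical
  rw [maxWeight]
  refine le_trans (Finset.le_sup (f := fun i => G.weight v v' i) (Finset.mem_univ i)) ?_
  exact Finset.le_sup (f := fun e : V × V => Finset.univ.sup fun i => G.weight e.1 e.2 i)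
    (b := (v, v')) (by simpa using h)

variable [DecidableEq V]

/-- Within `k` steps at most `k * W` is paid in each component, so a budget beyond this can be cut
off. Only `⊤` also allows the target to be missed. -/
theorem inf_mem_reach (k : ℕ) (v : V) {x : Profile d} (hx : x ∈ G.reach k v) :
    x = ⊤ ∨ x ⊓ (fun _ => ((k * G.maxWeight : ℕ) : ℕ∞)) ∈ G.reach k v := by
  induction k generalizing v x with
  | zero =>
    by_cases hv : v ∈ G.target
    · simp [G.reach_target hv]
    · rw [G.reach_zero hv] at hx
      exact .inl hx
  | succ k ih =>
    by_cases hv : v ∈ G.target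
    · simp [G.reach_target hv]
    have key : ∀ v' y, G.edge v v' → y ∈ G.reach k v' → x = y + G.weightProfile v v' →
        x = ⊤ ∨ ∃ z ∈ G.reach k v', x ⊓ (fun _ => (((k + 1) * G.maxWeight : ℕ) : ℕ∞)) =
          z + G.weightProfile v v' := by
      rintro v' y he hy rfl
      rcases ih v' hy with rfl | hmem
      · exact .inl (G.top_add_weightProfile v v')
      · right
        have hle : y ⊓ (fun _ => ((k * G.maxWeight : ℕ) : ℕ∞)) + G.weightProfile v v' ≤
            (y + G.weightProfile v v') ⊓ (fun _ => (((k + 1) * G.maxWeight : ℕ) : ℕ∞)) := by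
          refine le_inf (add_le_add_left inf_le_left _) fun i => ?_
          have hw : G.weightProfile v v' i ≤ (G.maxWeight : ℕ∞) :=
            Nat.cast_le.2 (G.weight_le_maxWeight he i)
          calc (y ⊓ (fun _ => ((k * G.maxWeight : ℕ) : ℕ∞)) + G.weightProfile v v') i
              ≤ ((k * G.maxWeight : ℕ) : ℕ∞) + G.maxWeight := add_le_add (inf_le_right (a := y i)) hw
            _ = (((k + 1) * G.maxWeight : ℕ) : ℕ∞) := by push_cast; ring
        obtain ⟨z, hz⟩ := G.exists_add_weightProfile (le_add_self.trans hle)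
        rw [hz] at hle
        exact ⟨z, G.mem_reach_of_le hmem (G.add_weightProfile_le.1 hle), hz⟩
    by_cases ho : G.owner v = Player.one
    · obtain ⟨v', he, y, hy, e⟩ := (G.mem_reach_succ_one hv ho).1 hx
      refine (key v' y he hy e).imp_right fun h => ?_
      exact (G.mem_reach_succ_one hv ho).2 ⟨v', he, h⟩
    · by_cases ht : x = ⊤
      · exact .inl ht
      · refine .inr ((G.mem_reach_succ_two hv ho).2 fun v' he => ?_)
        obtain ⟨y, hy, e⟩ := (G.mem_reach_succ_two hv ho).1 hx v' he
        exact (key v' y he hy e).resolve_left ht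

/-- A minimal profile equals its own truncation. Stabilization makes the bound independent of `k`.
-/
theorem iter_subset_box (k : ℕ) (v : V) :
    G.iter k v ⊆ box d ((Fintype.card V - 1) * G.maxWeight) := by
  have main : ∀ k, G.iter k v ⊆ box d (k * G.maxWeight) := by
    intro k x hx
    rw [iter_eq_minimals] at hx
    refine (G.inf_mem_reach k v hx.1).imp_right fun h i => ?_
    exact (hx.2 h inf_le_left i).trans inf_le_right
  rcases le_total (Fintype.card V - 1) k with hk | hk
  · rw [G.iter_eq_of_card_le hk]
    exact main _
  · refine (main k).trans fun x hx => hx.imp_right fun h i => (h i).trans ?_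
    exact Nat.cast_le.2 (Nat.mul_le_mul_right _ hk)

theorem box_mono {B C : ℕ} (h : B ≤ C) : box d B ⊆ box d C := fun _ hx =>
  hx.imp_right fun hx i => (hx i).trans (Nat.cast_le.2 h)

theorem add_mem_box {k : ℕ} {v v' : V} (he : G.edge v v') {x : Profile d}
    (hx : x ∈ G.iter k v') :
    x + G.weightProfile v v' ∈ box d (Fintype.card V * G.maxWeight) := by
  rcases G.iter_subset_box k v' hx with rfl | hx
  · exact .inl (G.top_add_weightProfile v v')
  · right
    intro i
    have hn : 1 ≤ Fintype.card V := Fintype.card_pos_iff.2 ⟨v⟩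
    have hw : G.weightProfile v v' i ≤ (G.maxWeight : ℕ∞) :=
      Nat.cast_le.2 (G.weight_le_maxWeight he i)
    refine (add_le_add (hx i) hw).trans ?_
    rw [← Nat.cast_add, Nat.cast_le]
    obtain ⟨m, hm⟩ : ∃ m, Fintype.card V = m + 1 := ⟨Fintype.card V - 1, by lia⟩
    rw [hm, Nat.add_sub_cancel, add_mul, one_mul]

omit [DecidableEq V] in
theorem eq_of_ne_of_card_le_two (h : Fintype.card V ≤ 2) {a b c : V} (hac : a ≠ c) (hbc : b ≠ c) :
    a = b := by
  by_contra hab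
  exact absurd (Fintype.two_lt_card_iff.2 ⟨a, b, c, hab, hac, hbc⟩) (by lia)

/-- One step already gives the limit, so a profile other than `⊤` at `v` comes from moving directly
into the target. -/
theorem eq_of_mem_iter_of_card_le_two (h : Fintype.card V ≤ 2) (k : ℕ) {v : V}
    (hv : v ∉ G.target) {x : Profile d} (hx : x ∈ G.iter k v) :
    x = ⊤ ∨ ∃ u ∈ G.target, x = G.weightProfile v u := by
  cases k with
  | zero => exact .inl (by rwa [G.iter_zero hv] at hx)
  | succ k =>
    -- Both `k + 1` and `1` are at least `|V| - 1`, so `I^(k+1)` may be replaced by `I^1`.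
    rw [G.iter_eq_of_card_le (by lia), ← G.iter_eq_of_card_le (k := 1) (by lia),
      iter_eq_minimals] at hx
    obtain ⟨hx, hmin⟩ := hx
    have key : ∀ v', (∃ y ∈ G.reach 0 v', x = y + G.weightProfile v v') → v' ∉ G.target →
        x = ⊤ := by
      rintro v' ⟨y, hy, rfl⟩ hv'
      rw [G.reach_zero hv'] at hy
      rw [Set.mem_singleton_iff.1 hy, top_add_weightProfile]
    have eq_of : ∀ v', (∃ y ∈ G.reach 0 v', x = y + G.weightProfile v v') →
        G.weightProfile v v' ∈ G.reach 1 v → x = G.weightProfile v v' := by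
      rintro v' ⟨y, -, rfl⟩ hmem
      exact le_antisymm (hmin hmem le_add_self) le_add_self
    have exists_reach : ∀ v' ∈ G.target, ∃ y ∈ G.reach 0 v',
        G.weightProfile v v' = y + G.weightProfile v v' := fun v' hv' =>
      ⟨0, by rw [G.reach_target hv']; trivial, (zero_add _).symm⟩
    by_cases ho : G.owner v = Player.one
    · obtain ⟨v', he, hy⟩ := (G.mem_reach_succ_one hv ho).1 hx
      by_cases hv' : v' ∈ G.target
      · exact .inr ⟨v', hv', eq_of v' hy
          ((G.mem_reach_succ_one hv ho).2 ⟨v', he, exists_reach v' hv'⟩)⟩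
      · exact .inl (key v' hy hv')
    · have hy := (G.mem_reach_succ_two hv ho).1 hx
      by_cases hall : ∀ v', G.edge v v' → v' ∈ G.target
      · obtain ⟨c, hc⟩ := G.exists_succ v
        refine .inr ⟨c, hall c hc, eq_of c (hy c hc)
          ((G.mem_reach_succ_two hv ho).2 fun v' he => ?_)⟩
        -- Successors in the target differ from `v`, so there is only one.
        obtain rfl : v' = c := eq_of_ne_of_card_le_two h (c := v)
          (fun e => hv (e ▸ hall v' he)) (fun e => hv (e ▸ hall c hc))
        exact exists_reach v' (hall v' he)
      · push Not at hall
        obtain ⟨v', he, hv'⟩ := hall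
        exact .inl (key v' (hy v' he) hv')

/-- A chain that contains all profiles met by the algorithm on a game with at most two vertices. -/
def smallChain : Set (Profile d) :=
  {x | x = 0 ∨ x = ⊤ ∨ ∃ a ∉ G.target, ∃ u ∈ G.target,
    x = G.weightProfile a u ∨ x = G.weightProfile a u + G.weightProfile a a}

omit [DecidableEq V] in
-- A non-target vertex `a` and a target vertex `u` are both unique once both exist, leaving `0 ≤
-- w(a,u) ≤ w(a,u) + w(a,a) ≤ ⊤`.
theorem narrow_smallChain (h : Fintype.card V ≤ 2) : Narrow G.smallChain 1 := by
  refine narrow_of_chain ?_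
  rintro x (rfl | rfl | ⟨a, ha, u, hu, hx⟩) y (rfl | rfl | ⟨b, hb, t, ht, hy⟩)
  all_goals try exact .inl le_top
  all_goals try exact .inr le_top
  all_goals try exact .inl fun _ => zero_le
  all_goals try exact .inr fun _ => zero_le
  obtain rfl : a = b := eq_of_ne_of_card_le_two h (c := u) (fun e => ha (e ▸ hu)) (fun e => hb (e ▸ hu))
  obtain rfl : u = t := eq_of_ne_of_card_le_two h (c := a) (fun e => ha (e ▸ hu)) (fun e => ha (e ▸ ht))
  rcases hx with rfl | rfl <;> rcases hy with rfl | rfl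
  · exact .inl le_rfl
  · exact .inl le_self_add
  · exact .inr le_self_add
  · exact .inl le_rfl

theorem iter_subset_smallChain (h : Fintype.card V ≤ 2) (k : ℕ) (v : V) :
    G.iter k v ⊆ G.smallChain := by
  intro x hx
  by_cases hv : v ∈ G.target
  · exact .inl (by rwa [G.iter_target hv] at hx)
  · rcases G.eq_of_mem_iter_of_card_le_two h k hv hx with rfl | ⟨u, hu, rfl⟩
    · exact .inr (.inl rfl)
    · exact .inr (.inr ⟨v, hv, u, hu, .inl rfl⟩)

/-- If `v'` is not a target but some target exists, then `v' = v` and the edge is a loop; this is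
the origin of `w(a,u) + w(a,a)`. -/
theorem add_mem_smallChain (h : Fintype.card V ≤ 2) {k : ℕ} {v v' : V} (hv : v ∉ G.target)
    {x : Profile d} (hx : x ∈ G.iter k v') : x + G.weightProfile v v' ∈ G.smallChain := by
  by_cases hv' : v' ∈ G.target
  · rw [G.iter_target hv'] at hx
    rw [Set.mem_singleton_iff.1 hx, zero_add]
    exact .inr (.inr ⟨v, hv, v', hv', .inl rfl⟩)
  · rcases G.eq_of_mem_iter_of_card_le_two h k hv' hx with rfl | ⟨u, hu, rfl⟩
    · exact .inr (.inl (G.top_add_weightProfile v v'))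
    · obtain rfl : v = v' := eq_of_ne_of_card_le_two h (fun e => hv (e ▸ hu))
        (fun e => hv' (e ▸ hu))
      exact .inr (.inr ⟨v, hv, u, hu, .inr rfl⟩)

theorem exists_fixpointAlgorithm_le [Nonempty V] (hd : 1 ≤ d) (L : SuccLists G) :
    ∃ (s : AlgState V d) (t : ℕ), G.FixpointAlgorithm L s t ∧
      (∀ v : V, {x | x ∈ s.I v} = G.pareto v) ∧
      t ≤ 75 * (d ^ 4 * (max G.maxWeight 1) ^ (4 * d) * Fintype.card V ^ (4 * d + 3)) := by
  have hn : 1 ≤ Fintype.card V := Fintype.card_pos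
  have hW : 1 ≤ max G.maxWeight 1 := le_max_right _ _
  have hWW : G.maxWeight ≤ max G.maxWeight 1 := le_max_left _ _
  have suff : ∀ (M : ℕ) (P : Set (Profile d)), 1 ≤ M → Narrow P M →
      (∀ k v, ∀ x ∈ G.iter k v, x ∈ P) →
      (∀ k, ∀ v ∉ G.target, ∀ v', G.edge v v' → ∀ x ∈ G.iter k v',
        x + G.weightProfile v v' ∈ P) →
      M ^ 3 ≤ (Fintype.card V * max G.maxWeight 1) ^ (4 * d) →
      ∃ (s : AlgState V d) (t : ℕ), G.FixpointAlgorithm L s t ∧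
        (∀ v : V, {x | x ∈ s.I v} = G.pareto v) ∧
        t ≤ 75 * (d ^ 4 * (max G.maxWeight 1) ^ (4 * d) * Fintype.card V ^ (4 * d + 3)) := by
    intro M P hM hP hmem hadd hle
    obtain ⟨s, t, hst, hpar, ht⟩ := exists_fixpointAlgorithm hd hM hP hmem hadd L
    refine ⟨s, t, hst, hpar, ht.trans (Nat.mul_le_mul_left 75 ?_)⟩
    calc Fintype.card V ^ 3 * (d * M ^ 3)
        ≤ Fintype.card V ^ 3 * (d ^ 4 * (Fintype.card V * max G.maxWeight 1) ^ (4 * d)) :=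
          Nat.mul_le_mul_left _ (Nat.mul_le_mul (Nat.le_self_pow four_ne_zero d) hle)
      _ = d ^ 4 * (max G.maxWeight 1) ^ (4 * d) * Fintype.card V ^ (4 * d + 3) := by
          rw [mul_pow, pow_add]
          ring
  rcases Nat.lt_or_ge 2 (Fintype.card V) with h | h
  · refine suff ((Fintype.card V * G.maxWeight + 1) ^ d) _ (Nat.pow_pos (Nat.succ_pos _))
      (narrow_box _) (fun k v x hx => box_mono (Nat.mul_le_mul_right _ (by lia))
        (G.iter_subset_box k v hx))
      (fun k v _ v' he x hx => G.add_mem_box he hx) ?_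
    -- At least three vertices and `W' ≥ 1` give `q ≥ 3`, as needed for `(q + 1) ^ 3 ≤ q ^ 4`.
    have hq : 3 ≤ Fintype.card V * max G.maxWeight 1 := Nat.mul_le_mul (show 3 ≤ _ from h) hW
    have hB : Fintype.card V * G.maxWeight ≤ Fintype.card V * max G.maxWeight 1 :=
      Nat.mul_le_mul_left _ hWW
    generalize Fintype.card V * max G.maxWeight 1 = q at *
    rw [← pow_mul, mul_comm d 3, pow_mul, pow_mul]
    refine Nat.pow_le_pow_left (le_trans (Nat.pow_le_pow_left (Nat.succ_le_succ hB) 3) ?_) d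
    obtain ⟨r, rfl⟩ := Nat.exists_eq_add_of_le hq
    -- This is the expansion of `q ^ 4 - (q + 1) ^ 3` at `q = 3 + r`.
    exact Nat.le.intro (k := 17 + 60 * r + 42 * r ^ 2 + 11 * r ^ 3 + r ^ 4)
      (by rw [Nat.succ_eq_add_one]; ring)
  · refine suff 1 _ le_rfl (G.narrow_smallChain h)
      (fun k v x hx => G.iter_subset_smallChain h k v hx)
      (fun k v hv v' _ x hx => G.add_mem_smallChain h hv hx) ?_
    rw [one_pow]
    exact Nat.one_le_pow _ _ (Nat.mul_pos hn hW)

end Game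

theorem mainTheorem5 :
    (∃ C : ℕ, ∀ (d : ℕ) (V : Type*) [Fintype V] [DecidableEq V] [Nonempty V]
      (G : Game V d) (L : SuccLists G), 1 ≤ d →
      (∀ (k : ℕ) (v : V), {x | x ∈ (G.stateAfter L k).I v} = G.iter k v) ∧
      ∃ (s : AlgState V d) (t : ℕ), G.FixpointAlgorithm L s t ∧
        (∀ v : V, {x | x ∈ s.I v} = G.pareto v) ∧
        t ≤ C * (d ^ 4 * (max G.maxWeight 1) ^ (4 * d) * Fintype.card V ^ (4 * d + 3))) ∧
    (∀ d : ℕ, 1 ≤ d → ∃ p : Polynomial ℕ, ∀ (V : Type*) [Fintype V] [DecidableEq V] [Nonempty V]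
      (G : Game V d) (L : SuccLists G),
      ∃ (s : AlgState V d) (t : ℕ), G.FixpointAlgorithm L s t ∧
        (∀ v : V, {x | x ∈ s.I v} = G.pareto v) ∧
        t ≤ p.eval (G.maxWeight + Fintype.card V)) := by
  refine ⟨⟨75, fun d V _ _ _ G L hd => ⟨fun k v => (Game.represents_stateAfter L k).setOf_mem v,
    G.exists_fixpointAlgorithm_le hd L⟩⟩, fun d hd => ?_⟩
  -- As `|V| ≥ 1`, both `W'` and `|V|` are at most `W + |V|`, so the exponents `4 * d` and `4 * d +
  -- 3` add up.
  refine ⟨Polynomial.C (75 * d ^ 4) * Polynomial.X ^ (4 * d + (4 * d + 3)), fun V _ _ _ G L => ?_⟩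
  obtain ⟨s, t, hst, hpar, ht⟩ := G.exists_fixpointAlgorithm_le hd L
  refine ⟨s, t, hst, hpar, ht.trans ?_⟩
  have hn : 1 ≤ Fintype.card V := Fintype.card_pos
  have h1 : max G.maxWeight 1 ≤ G.maxWeight + Fintype.card V := max_le (by lia) (by lia)
  have h2 : Fintype.card V ≤ G.maxWeight + Fintype.card V := Nat.le_add_left _ _
  rw [Polynomial.eval_mul, Polynomial.eval_C, Polynomial.eval_pow, Polynomial.eval_X,
    pow_add _ (4 * d) (4 * d + 3)]
  calc 75 * (d ^ 4 * max G.maxWeight 1 ^ (4 * d) * Fintype.card V ^ (4 * d + 3))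
      = 75 * d ^ 4 * (max G.maxWeight 1 ^ (4 * d) * Fintype.card V ^ (4 * d + 3)) := by
        simp only [mul_assoc]
    _ ≤ _ := Nat.mul_le_mul_left _
        (Nat.mul_le_mul (Nat.pow_le_pow_left h1 _) (Nat.pow_le_pow_left h2 _))
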